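/- Let $F=\mathbb{F}_q$ be a finite field with $q$ elements and characteristic $p$, let $n\ge 3$, and let $V$ be an $n$-dimensional $F$-vector space with a non-singular quadratic form $Q$, i.e. one whose associated bilinear form $\beta(u,v)=Q(u+v)-Q(u)-Q(v)$ is non-degenerate. Let $\mathrm{O}^{\epsilon}(n,q)$, with $\epsilon\in\{+,-,\circ\}$ the type of $Q$, be the group of linear automorphisms of $V$ preserving $Q$, and let $\mathrm{SO}^{\epsilon}(n,q)$ be its subgroup of elements of determinant $1$. For $x\in \mathrm{O}^{\epsilon}(n,q)$ put $V_x=\mathrm{im}(\mathbf{1}_V-x)$, and define the spinor norm $\theta(x)\in\mathbb{F}_2$ as follows. If $q$ is even, $\theta(x)=\dim V_x \bmod 2$. If $q$ is odd, $\theta(x)=0$ if the determinant of a Gram matrix of the Wall form $\chi_x(u,v)=\beta(w,v)$ on $V_x$, where $w\in V$ is any vector with $u=w-xw$, is a square in $F$, and $\theta(x)=1$ otherwise. Let $\Omega^{\epsilon}(n,q)=\{x\in \mathrm{SO}^{\epsilon}(n,q):\theta(x)=0\}$. Let $x\in\Omega^{\epsilon}(n,q)$ be semisimple, i.e. of order coprime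 to $p$. Write $x^g=g^{-1}xg$. (1) If $q$ is odd, or if $q$ is even and $x+\mathbf{1}_V$ is singular, then the conjugacy class of $x$ in $\Omega^{\epsilon}(n,q)$ coincides with the conjugacy class of $x$ in $\mathrm{SO}^{\epsilon}(n,q)$. (2) If $q$ is even and $x+\mathbf{1}_V$ is non-singular, then $\mathrm{SO}^{\epsilon}(n,q)\setminus\Omega^{\epsilon}(n,q)$ is non-empty and, for every $z\in \mathrm{SO}^{\epsilon}(n,q)\setminus\Omega^{\epsilon}(n,q)$, the element $x^z$ lies in $\Omega^{\epsilon}(n,q)$ and the conjugacy class of $x$ in $\mathrm{SO}^{\epsilon}(n,q)$ is the disjoint union of the conjugacy classes of $x$ and of $x^z$ in $\Omega^{\epsilon}(n,q)$. -/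

import Mathlib

noncomputable section

namespace FiniteOrthogonal

variable {F V : Type*} [Field F] [AddCommGroup V] [Module F V]

/-- A quadratic form `Q` is non-singular if its associated bilinear form
`β_Q(u,v) = Q(u+v) - Q(u) - Q(v)` is non-degenerate. -/
def NonSingular (Q : QuadraticForm F V) : Prop :=
  (QuadraticMap.polarBilin Q).Nondegenerate

/-- The orthogonal group of `Q`: the linear automorphisms of `V` that preserve `Q`.
When `Q` runs over the non-singular quadratic forms on an `n`-dimensional space over the field
with `q` elements, this runs over the groups `O^ε(n,q)`, for all types `ε`. -/
def O (Q : QuadraticForm F V) : Subgroup (V ≃ₗ[F] V) where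
  carrier := {x | ∀ v, Q (x v) = Q v}
  one_mem' := fun _ => rfl
  mul_mem' := by
    intro x y hx hy v
    rw [LinearEquiv.mul_apply, hx, hy]
  inv_mem' := by
    intro x hx v
    rw [← hx (x⁻¹ v), ← LinearEquiv.mul_apply, mul_inv_cancel, LinearEquiv.coe_one, id]

/-- The special orthogonal group of `Q`: the isometries of determinant `1`. -/
def SO (Q : QuadraticForm F V) : Subgroup (V ≃ₗ[F] V) :=
  O Q ⊓ (LinearEquiv.det : (V ≃ₗ[F] V) →* Fˣ).ker

/-- The endomorphism `1 - x` of `V`. -/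
def oneSub (x : V ≃ₗ[F] V) : V →ₗ[F] V := LinearMap.id - (x : V →ₗ[F] V)

/-- The subspace `V_x`, the image of `1 - x`. -/
def residual (x : V ≃ₗ[F] V) : Submodule F V := LinearMap.range (oneSub x)

/-- A linear choice, for every `u` in `V_x`, of a vector `w` with `u = w - x w`. -/
def preimage (x : V ≃ₗ[F] V) : residual x →ₗ[F] V :=
  Classical.choose ((oneSub x).rangeRestrict.exists_rightInverse_of_surjective
    (oneSub x).range_rangeRestrict)

theorem preimage_spec (x : V ≃ₗ[F] V) (u : residual x) :
    preimage x u - x (preimage x u) = u := by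
  have h := Classical.choose_spec ((oneSub x).rangeRestrict.exists_rightInverse_of_surjective
    (oneSub x).range_rangeRestrict)
  exact congrArg Subtype.val (LinearMap.congr_fun h u)

/-- The Wall form `χ_x` on `V_x`: `χ_x(u,v) = β_Q(w,v)` where `u = w - x w`. -/
def wallForm (Q : QuadraticForm F V) (x : V ≃ₗ[F] V) : LinearMap.BilinForm F (residual x) :=
  ((QuadraticMap.polarBilin Q).comp (preimage x)).compl₂ (residual x).subtype

/-- For an isometry `x`, the Wall form does not depend on the choice of `w`. -/
theorem wallForm_eq (Q : QuadraticForm F V) (x : V ≃ₗ[F] V) (hx : x ∈ O Q)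
    (u v : residual x) (w : V) (hw : w - x w = u) :
    wallForm Q x u v = QuadraticMap.polar Q w v := by
  have hpol : ∀ a b : V, QuadraticMap.polar Q (x a) (x b) = QuadraticMap.polar Q a b := by
    intro a b
    have h : ∀ c, Q (x c) = Q c := hx
    simp only [QuadraticMap.polar, ← map_add, h]
  obtain ⟨v, w', rfl⟩ := v
  have hfix : x (preimage x u - w) = preimage x u - w := by
    have h := preimage_spec x u
    rw [← hw] at h
    rw [map_sub]
    have h2 : preimage x u - w - (x (preimage x u) - x w) = 0 := by
      rw [sub_sub_sub_comm, h, sub_self]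
    exact (sub_eq_zero.mp h2).symm
  have h0 : QuadraticMap.polar Q (preimage x u - w) (w' - x w') = 0 := by
    rw [QuadraticMap.polar_sub_right, sub_eq_zero, ← hpol _ w', hfix]
  rw [QuadraticMap.polar_sub_left, sub_eq_zero] at h0
  exact h0

open Classical in
/-- The spinor norm `θ(x)`, with values in the field with two elements. For `q` even it is the
dimension of `V_x` modulo `2`. For `q` odd it is `0` if the determinant of the Gram matrix of the
Wall form (in any basis of `V_x`; the choice only changes it by a square) is a square, and `1` otherwise. -/
def spinorNorm [FiniteDimensional F V] (Q : QuadraticForm F V) (x : V ≃ₗ[F] V) : ZMod 2 :=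
  if Even (Nat.card F) then (Module.finrank F (residual x) : ZMod 2)
  else if IsSquare (LinearMap.BilinForm.toMatrix
      (Module.finBasis F (residual x)) (wallForm Q x)).det then 0 else 1

/-- The Omega group of `Q`: the kernel of the spinor norm on the special orthogonal group. -/
def Omega [FiniteDimensional F V] (Q : QuadraticForm F V) : Set (V ≃ₗ[F] V) :=
  {x | x ∈ SO Q ∧ spinorNorm Q x = 0}

/-- An automorphism of `V` is semisimple if its order is coprime to the characteristic. -/
def Semisimple (x : V ≃ₗ[F] V) : Prop := (orderOf x).Coprime (ringChar F)

/-- The conjugacy class of `x` under the elements of `H`: all `x^g = g⁻¹ x g` with `g ∈ H`. -/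
def conjClass {G : Type*} [Group G] (H : Set G) (x : G) : Set G :=
  {y | ∃ g ∈ H, y = g⁻¹ * x * g}

end FiniteOrthogonal

end

-- The spinor norm is a homomorphism on `O Q`, so `Omega Q` has index at most two in `SO Q`. Hence
-- the `SO`-class of x splits exactly when the centralizer of x in `SO Q` lies in `Omega Q`, and
-- everything reduces to whether x commutes with some c in `SO Q` of spinor norm 1.
--
-- Homomorphism: for q odd, reflections generate `O Q`, and multiplying by the reflection in u
-- multiplies the Wall discriminant by Q(u) modulo squares (`wallSign_refl_mul`). For q even, the
-- difference of the Wall forms of y and x⁻¹ is alternating on the intersection of their residual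
-- spaces, so its rank is even (`even_finrank_residual_mul`).
--
-- For q even, `SO Q = O Q`. If x fixes a nonzero vector, semisimplicity makes the fixed space
-- non-degenerate, so it contains u with Q(u) ≠ 0; the reflection in u commutes with x and has
-- spinor norm 1. If x has no nonzero fixed vector and g commutes with x, then x acts on V_g as an
-- isometry of the non-degenerate Wall form of g without eigenvalue 1. Its characteristic polynomial
-- is self-reciprocal, and in characteristic two this forces even degree
-- (`even_finrank_residual_of_commute`).
--
-- For q odd a suitable c always exists. If x² = 1, some eigenspace is non-degenerate of dimension
-- at least 2 and c is a product of two reflections. Otherwise take an irreducible invariant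
-- subspace on which x² ≠ 1. The polynomials in x form a finite field there, and surjectivity of the
-- norm gives one, a, of non-square determinant. With b the adjoint of a, the isometry c = a b⁻¹,
-- extended by the identity, has Wall discriminant det a modulo squares, because b − a is
-- skew-adjoint and alternating forms have square determinant (`exists_commute_of_adjoint`). A
-- totally isotropic subspace is first enlarged by a dual one.

universe u w

noncomputable section

namespace FiniteOrthogonal

/-! ### Gram determinants of alternating forms -/

section Alternating

variable {F V : Type*} [Field F] [AddCommGroup V] [Module F V]

/-- The determinant of an alternating matrix is a square, and vanishes in odd size. -/
theorem alternating_matrix_det {F : Type u} [Field F] (m : ℕ) :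
    ∀ {n : Type w} [Fintype n] [DecidableEq n] (A : Matrix n n F), Fintype.card n = m →
      (∀ v, dotProduct v (A.mulVec v) = 0) →
      IsSquare A.det ∧ (A.det ≠ 0 → Even (Fintype.card n)) := by
  induction m using Nat.strong_induction_on with
  | _ m ih =>
  intro n _ _ A hm hA
  have hpair : ∀ v w, dotProduct v (A.mulVec w) = - dotProduct w (A.mulVec v) := by
    intro v w
    have h := hA (v + w)
    rw [Matrix.mulVec_add, add_dotProduct, dotProduct_add, dotProduct_add, hA, hA] at h
    linear_combination h
  have hentry : ∀ i j, A i j = - A j i := by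
    intro i j
    simpa using hpair (Pi.single i 1) (Pi.single j 1)
  have hdiag : ∀ i, A i i = 0 := by
    intro i
    simpa using hA (Pi.single i 1)
  by_cases h0 : ∃ i j, A i j ≠ 0
  swap
  · push Not at h0
    have : A = 0 := by ext i j; exact h0 i j
    subst this
    rcases isEmpty_or_nonempty n with hn | hn
    · simp
    · simp [Matrix.det_zero]
  obtain ⟨i, j, hij⟩ := h0
  have hne : i ≠ j := by rintro rfl; exact hij (hdiag i)
  -- The block on the indices i, j has determinant `A i j ^ 2`; its Schur complement is smaller and
  -- again alternating.
  set p : n → Prop := fun k => k = i ∨ k = j with hp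
  rw [Matrix.det_toBlock A p]
  set A₁ := A.toBlock p p
  set B := A.toBlock p (fun k => ¬ p k)
  set C := A.toBlock (fun k => ¬ p k) p
  set D := A.toBlock (fun k => ¬ p k) (fun k => ¬ p k)
  let e : Fin 2 ≃ {k // p k} := Equiv.ofBijective ![⟨i, Or.inl rfl⟩, ⟨j, Or.inr rfl⟩] (by
    constructor
    · intro a b
      fin_cases a <;> fin_cases b <;> simp [hne, hne.symm]
    · rintro ⟨k, rfl | rfl⟩
      · exact ⟨0, rfl⟩
      · exact ⟨1, rfl⟩)
  have hdet : A₁.det = A i j ^ 2 := by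
    rw [← Matrix.det_submatrix_equiv_self e, Matrix.det_fin_two]
    have h0 : e 0 = ⟨i, Or.inl rfl⟩ := rfl
    have h1 : e 1 = ⟨j, Or.inr rfl⟩ := rfl
    simp only [A₁, Matrix.toBlock, Matrix.submatrix_apply, h0, h1, hdiag, hentry j i]
    ring
  have hunit : IsUnit A₁.det := by rw [hdet]; exact (pow_ne_zero _ hij).isUnit
  have hunit' : IsUnit A₁ := (Matrix.isUnit_iff_isUnit_det _).2 hunit
  let := hunit'.invertible
  rw [Matrix.det_fromBlocks₁₁, hdet]
  have hcard : Fintype.card {k // ¬ p k} + 2 = m := by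
    have h1 := Fintype.card_congr (Equiv.sumCompl p)
    have h2 := Fintype.card_congr e
    rw [Fintype.card_sum, ← h2, Fintype.card_fin, hm] at h1
    omega
  have halt : ∀ v, dotProduct v ((D - C * ⅟A₁ * B).mulVec v) = 0 := by
    intro v
    -- With this w the vector (w, v) is orthogonal to the first block, so the Schur complement at v
    -- is the original form at (w, v).
    set w : {k // p k} → F := - (⅟A₁).mulVec (B.mulVec v) with hw
    have h1 : A₁.mulVec w = - B.mulVec v := by
      rw [hw, Matrix.mulVec_neg, Matrix.mulVec_mulVec, mul_invOf_self, Matrix.one_mulVec]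
    have h2 := hA (Sum.elim w v ∘ (Equiv.sumCompl p).symm)
    have h3 : A = (Matrix.fromBlocks A₁ B C D).submatrix (Equiv.sumCompl p).symm
        (Equiv.sumCompl p).symm := by
      ext a b
      obtain ⟨a, rfl⟩ := (Equiv.sumCompl p).surjective a
      obtain ⟨b, rfl⟩ := (Equiv.sumCompl p).surjective b
      rcases a with a | a <;> rcases b with b | b <;>
        simp [A₁, B, C, D, Matrix.toBlock]
    rw [h3, Matrix.submatrix_mulVec_equiv, Equiv.symm_symm, Function.comp_assoc,
      Equiv.symm_comp_self, Function.comp_id, comp_equiv_dotProduct_comp_equiv,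
      Matrix.fromBlocks_mulVec, sumElim_dotProduct_sumElim] at h2
    simp only [Sum.elim_comp_inl, Sum.elim_comp_inr] at h2
    rw [h1, neg_add_cancel, dotProduct_zero, zero_add] at h2
    rw [← h2, Matrix.sub_mulVec, ← Matrix.mulVec_mulVec, ← Matrix.mulVec_mulVec, hw,
      Matrix.mulVec_neg, neg_add_eq_sub]
  obtain ⟨⟨r, hr⟩, h2⟩ := ih _ (by omega) (D - C * ⅟A₁ * B) rfl halt
  refine ⟨⟨A i j * r, by rw [hr]; ring⟩, fun h => ?_⟩
  have := h2 (right_ne_zero_of_mul h)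
  rw [hm, ← hcard]
  exact this.add even_two

theorem isAlt_dotProduct_toMatrix {ι : Type*} [Fintype ι] [DecidableEq ι] {ω : LinearMap.BilinForm F V}
    (hω : ω.IsAlt) (b : Module.Basis ι F V) (v : ι → F) :
    dotProduct v ((LinearMap.BilinForm.toMatrix b ω).mulVec v) = 0 := by
  have h := LinearMap.BilinForm.dotProduct_toMatrix_mulVec b ω v v
  rw [h]
  exact hω _

theorem isSquare_det_of_isAlt {ι : Type*} [Fintype ι] [DecidableEq ι] {ω : LinearMap.BilinForm F V}
    (hω : ω.IsAlt) (b : Module.Basis ι F V) :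
    IsSquare (LinearMap.BilinForm.toMatrix b ω).det :=
  (alternating_matrix_det _ _ rfl (isAlt_dotProduct_toMatrix hω b)).1

theorem even_finrank_of_isAlt [FiniteDimensional F V] {ω : LinearMap.BilinForm F V}
    (hω : ω.IsAlt) (hnd : ω.Nondegenerate) : Even (Module.finrank F V) := by
  classical
  let b := Module.finBasis F V
  have h := (alternating_matrix_det _ _ rfl (isAlt_dotProduct_toMatrix hω b)).2
  rw [Fintype.card_fin] at h
  exact h ((LinearMap.BilinForm.nondegenerate_iff_det_ne_zero b).1 hnd)

/-- Whether a Gram determinant is a square does not depend on the basis. -/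
theorem isSquare_det_toMatrix_iff {ι κ : Type*} [Fintype ι] [DecidableEq ι] [Fintype κ]
    [DecidableEq κ] (b : Module.Basis ι F V) (c : Module.Basis κ F V) (B : LinearMap.BilinForm F V) :
    IsSquare (LinearMap.BilinForm.toMatrix b B).det ↔
      IsSquare (LinearMap.BilinForm.toMatrix c B).det := by
  have key : ∀ {ι : Type _} [Fintype ι] [DecidableEq ι] (b c : Module.Basis ι F V),
      IsSquare (LinearMap.BilinForm.toMatrix b B).det →
      IsSquare (LinearMap.BilinForm.toMatrix c B).det := by
    intro ι _ _ b c h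
    rw [← LinearMap.BilinForm.toMatrix_mul_basis_toMatrix b c B, Matrix.det_mul, Matrix.det_mul,
      Matrix.det_transpose, mul_right_comm]
    exact (IsSquare.mul_self _).mul h
  let e := c.indexEquiv b
  have hre : LinearMap.BilinForm.toMatrix (c.reindex e) B =
      (LinearMap.BilinForm.toMatrix c B).submatrix e.symm e.symm := by
    ext i j
    simp [LinearMap.BilinForm.toMatrix_apply]
  have hdet : (LinearMap.BilinForm.toMatrix (c.reindex e) B).det =
      (LinearMap.BilinForm.toMatrix c B).det := by
    rw [hre, Matrix.det_submatrix_equiv_self]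
  rw [← hdet]
  exact ⟨key _ _, key _ _⟩

end Alternating

/-! ### Reflections, normalised by Q(u) so that characteristic two is included -/

section Reflections

open QuadraticMap Module
variable {F V : Type*} [Field F] [AddCommGroup V] [Module F V]

section Basic

variable {Q : QuadraticForm F V} {x : V ≃ₗ[F] V}

theorem polar_map (hx : x ∈ O Q) (a b : V) : polar Q (x a) (x b) = polar Q a b := by
  have h : ∀ c, Q (x c) = Q c := hx
  simp only [polar, ← map_add, h]

theorem polar_symm_map (hx : x ∈ O Q) (a b : V) : polar Q (x a) b = polar Q a (x.symm b) := by
  rw [← polar_map hx a, LinearEquiv.apply_symm_apply]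

theorem isSymm_polarBilin (Q : QuadraticForm F V) : (polarBilin Q).IsSymm :=
  ⟨fun a b => polar_comm Q a b⟩

theorem isRefl_polarBilin (Q : QuadraticForm F V) : (polarBilin Q).IsRefl :=
  (isSymm_polarBilin Q).isRefl

theorem eq_zero_of_polar (hQ : NonSingular Q) {v : V} (h : ∀ w, polar Q v w = 0) : v = 0 :=
  hQ.1 v h

theorem map_add_polar (Q : QuadraticForm F V) (a b : V) : Q (a + b) = Q a + Q b + polar Q a b :=
  QuadraticMap.map_add Q a b

theorem polar_self_two (Q : QuadraticForm F V) (u : V) : polar Q u u = 2 * Q u := by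
  simp [two_mul]

/-- `V_x` is the orthogonal complement of the space of fixed vectors of `x`. -/
theorem residual_eq_orthogonal [FiniteDimensional F V] (hQ : NonSingular Q) (hx : x ∈ O Q) :
    residual x = LinearMap.BilinForm.orthogonal (polarBilin Q) (LinearMap.ker (oneSub x)) := by
  apply Submodule.eq_of_le_of_finrank_eq
  · rintro _ ⟨w, rfl⟩
    rw [LinearMap.BilinForm.mem_orthogonal_iff]
    intro v hv
    have hv' : x v = v := (sub_eq_zero.1 (LinearMap.mem_ker.1 hv)).symm
    change polar Q v (w - x w) = 0
    rw [polar_sub_right, sub_eq_zero, ← polar_map hx v w, hv']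
  · rw [LinearMap.BilinForm.finrank_orthogonal hQ]
    have := LinearMap.finrank_range_add_finrank_ker (oneSub x)
    change finrank F (LinearMap.range (oneSub x)) = _
    omega

theorem exists_fixed_polar_ne_zero [FiniteDimensional F V] (hQ : NonSingular Q) (hx : x ∈ O Q)
    {u : V} (hu : u ∉ residual x) : ∃ w, x w = w ∧ polar Q w u ≠ 0 := by
  rw [residual_eq_orthogonal hQ hx, LinearMap.BilinForm.mem_orthogonal_iff] at hu
  push Not at hu
  obtain ⟨w, hw, h⟩ := hu
  exact ⟨w, (sub_eq_zero.1 (LinearMap.mem_ker.1 hw)).symm, h⟩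

theorem polar_fixed_residual (hx : x ∈ O Q) {w u : V} (hw : x w = w) (hu : u ∈ residual x) :
    polar Q w u = 0 := by
  obtain ⟨v, rfl⟩ := hu
  change polar Q w (v - x v) = 0
  rw [polar_sub_right, sub_eq_zero, ← polar_map hx w v, hw]

/-- The orthogonal reflection in the vector `u` with `Q u ≠ 0`. -/
def refl (Q : QuadraticForm F V) {u : V} (hu : Q u ≠ 0) : V ≃ₗ[F] V :=
  Module.reflection (x := u) (f := (Q u)⁻¹ • polarBilin Q u) (by
    rw [LinearMap.smul_apply, polarBilin_apply_apply, polar_self_two, smul_eq_mul, mul_comm,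
      mul_assoc, mul_inv_cancel₀ hu, mul_one])

theorem refl_apply {u : V} (hu : Q u ≠ 0) (v : V) :
    refl Q hu v = v - ((Q u)⁻¹ * polar Q u v) • u := rfl

theorem refl_refl {u : V} (hu : Q u ≠ 0) : refl Q hu * refl Q hu = 1 := by
  ext v
  exact Module.involutive_reflection _ v

theorem refl_mem {u : V} (hu : Q u ≠ 0) : refl Q hu ∈ O Q := by
  intro v
  rw [refl_apply, sub_eq_add_neg, ← neg_smul, map_add_polar, QuadraticMap.map_smul,
    polar_smul_right, smul_eq_mul, smul_eq_mul, polar_comm Q v u]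
  field_simp
  ring

theorem det_refl [FiniteDimensional F V] {u : V} (hu : Q u ≠ 0) :
    LinearEquiv.det (refl Q hu) = -1 := by
  ext
  rw [LinearEquiv.coe_det]
  have : (refl Q hu : V →ₗ[F] V) = LinearMap.transvection (-((Q u)⁻¹ • polarBilin Q u)) u := by
    ext v
    rw [LinearMap.transvection.apply]
    simp [refl_apply, sub_eq_add_neg]
  rw [this, LinearMap.transvection.det]
  have := polar_self_two Q u
  simp only [LinearMap.neg_apply, LinearMap.smul_apply, polarBilin_apply_apply, smul_eq_mul, this,
    Units.val_neg, Units.val_one]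
  field_simp
  norm_num

/-- Conjugating by x turns the reflection in u into the reflection in `c • u`, which is the same
since c = ±1. -/
theorem refl_commute {u : V} (hu : Q u ≠ 0) (hx : x ∈ O Q) {c : F} (hc : c * c = 1)
    (hxu : x u = c • u) : Commute (refl Q hu) x := by
  ext v
  have h1 : polar Q u (x v) = c * polar Q u v := by
    have h2 : u = c • x u := by rw [hxu, smul_smul, hc, one_smul]
    conv_lhs => rw [h2]
    rw [polar_smul_left, polar_map hx, smul_eq_mul]
  simp only [LinearEquiv.mul_apply, refl_apply, map_sub, map_smul, hxu, h1, smul_smul]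
  congr 2
  ring

theorem sub_refl_mul_apply {u : V} (hu : Q u ≠ 0) (y : V ≃ₗ[F] V) (w : V) :
    w - (refl Q hu * y) w = (w - y w) + ((Q u)⁻¹ * polar Q u (y w)) • u := by
  rw [LinearEquiv.mul_apply, refl_apply]
  abel

theorem oneSub_apply (x : V ≃ₗ[F] V) (w : V) : oneSub x w = w - x w := rfl

end Basic

/-! ### Wall discriminants and multiplication by a reflection -/

section Gram
variable {Q : QuadraticForm F V} {x : V ≃ₗ[F] V}

/-- The matrix of the pairings of `w` with `v`. When `v` is a basis of `V_x` and `v = w - x w`,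
it is a Gram matrix of the Wall form. -/
def gram (Q : QuadraticForm F V) {ι : Type*} (w v : ι → V) : Matrix ι ι F :=
  Matrix.of fun i j => polar Q (w i) (v j)

/-- A vector t of V_x in the kernel is orthogonal to every `w i`. Any y differs from a combination
of the `w i` by a fixed vector of x, and fixed vectors are orthogonal to V_x; so t is orthogonal to
all of V. -/
theorem det_gram_ne_zero {ι : Type*} [Fintype ι] [DecidableEq ι] (hQ : NonSingular Q)
    (hx : x ∈ O Q) {w v : ι → V} (hli : LinearIndependent F v)
    (hspan : Submodule.span F (Set.range v) = residual x) (hw : ∀ i, w i - x (w i) = v i) :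
    (gram Q w v).det ≠ 0 := by
  intro h0
  obtain ⟨c, hc, h⟩ := Matrix.exists_mulVec_eq_zero_iff.2 h0
  apply hc
  set t := ∑ i, c i • v i with ht
  have htmem : t ∈ residual x := by
    rw [← hspan]
    exact Submodule.sum_mem _ fun i _ => Submodule.smul_mem _ _ (Submodule.subset_span ⟨i, rfl⟩)
  have h1 : ∀ i, polar Q (w i) t = 0 := by
    intro i
    have := congrFun h i
    change polarBilin Q (w i) t = 0
    rw [ht, map_sum]
    simpa [Matrix.mulVec, dotProduct, gram, mul_comm] using this
  have h2 : t = 0 := by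
    apply eq_zero_of_polar hQ
    intro y
    rw [polar_comm]
    have hy : y - x y ∈ Submodule.span F (Set.range v) := hspan ▸ ⟨y, rfl⟩
    obtain ⟨d, hd⟩ := (Submodule.mem_span_range_iff_exists_fun F).1 hy
    have hfix : x (y - ∑ i, d i • w i) = y - ∑ i, d i • w i := by
      have : ∑ i, d i • w i - x (∑ i, d i • w i) = y - x y := by
        rw [← hd, map_sum, ← Finset.sum_sub_distrib]
        exact Finset.sum_congr rfl fun i _ => by rw [map_smul, ← smul_sub, hw]
      rw [map_sub]
      have h3 : y - ∑ i, d i • w i - (x y - x (∑ i, d i • w i)) = 0 := by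
        rw [sub_sub_sub_comm, this, sub_self]
      exact (sub_eq_zero.1 h3).symm
    have h4 := polar_fixed_residual hx hfix htmem
    rw [polar_sub_left, sub_eq_zero] at h4
    rw [h4]
    change polarBilin Q (∑ i, d i • w i) t = 0
    rw [map_sum (polarBilin Q), LinearMap.sum_apply]
    exact Finset.sum_eq_zero fun i _ => by simp [h1]
  exact funext (Fintype.linearIndependent_iff.1 hli c h2)

variable [FiniteDimensional F V]

theorem isSquare_det_wallForm_iff {ι : Type*} [Fintype ι] [DecidableEq ι] 
    (hx : x ∈ O Q) {w v : ι → V} (hli : LinearIndependent F v)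
    (hspan : Submodule.span F (Set.range v) = residual x) (hw : ∀ i, w i - x (w i) = v i) :
    IsSquare (LinearMap.BilinForm.toMatrix (finBasis F (residual x)) (wallForm Q x)).det ↔
      IsSquare (gram Q w v).det := by
  let b : Basis ι F (residual x) := (Basis.span hli).map (LinearEquiv.ofEq _ _ hspan)
  have hb : ∀ i, ((b i : residual x) : V) = v i := by
    intro i
    simp [b, Basis.span_apply]
  have h : LinearMap.BilinForm.toMatrix b (wallForm Q x) = gram Q w v := by
    ext i j
    rw [LinearMap.BilinForm.toMatrix_apply, wallForm_eq Q x hx _ _ (w i) (by rw [hw, hb]), hb]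
    rfl
  rw [isSquare_det_toMatrix_iff _ b, h]

theorem exists_gram (Q : QuadraticForm F V) (x : V ≃ₗ[F] V) :
    ∃ w v : Fin (finrank F (residual x)) → V,
    LinearIndependent F v ∧ Submodule.span F (Set.range v) = residual x ∧
      (∀ i, w i - x (w i) = v i) ∧
      LinearMap.BilinForm.toMatrix (finBasis F (residual x)) (wallForm Q x) = gram Q w v := by
  refine ⟨fun i => preimage x (finBasis F (residual x) i), fun i => finBasis F (residual x) i,
    ?_, ?_, fun i => preimage_spec x _, ?_⟩
  · exact (finBasis F (residual x)).linearIndependent.map' (residual x).subtype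
      (Submodule.ker_subtype _)
  rotate_left
  · ext i j
    rw [LinearMap.BilinForm.toMatrix_apply]
    rfl
  · have : Set.range (fun i => ((finBasis F (residual x) i : residual x) : V)) =
        (residual x).subtype '' Set.range (finBasis F (residual x)) := by
      rw [← Set.range_comp]; rfl
    rw [this, ← Submodule.map_span, Basis.span_eq, Submodule.map_top, Submodule.range_subtype]

variable [Fintype F] [DecidableEq F]

/-- The quadratic character of the discriminant of the Wall form. -/
def wallSign (Q : QuadraticForm F V) (x : V ≃ₗ[F] V) : ℤ :=
  quadraticChar F (LinearMap.BilinForm.toMatrix (finBasis F (residual x)) (wallForm Q x)).det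

/-- Frees the sign from the chosen basis and preimages: on nonzero determinants the quadratic
character records only squareness, and that is basis-independent. -/
theorem wallSign_eq {ι : Type*} [Fintype ι] [DecidableEq ι] (hQ : NonSingular Q)
    (hx : x ∈ O Q) {w v : ι → V} (hli : LinearIndependent F v)
    (hspan : Submodule.span F (Set.range v) = residual x) (hw : ∀ i, w i - x (w i) = v i) :
    wallSign Q x = quadraticChar F (gram Q w v).det := by
  have h1 := det_gram_ne_zero hQ hx hli hspan hw
  have h2 : (LinearMap.BilinForm.toMatrix (finBasis F (residual x)) (wallForm Q x)).det ≠ 0 := by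
    obtain ⟨w', v', hli', hspan', hw', h⟩ := exists_gram Q x
    rw [h]
    exact det_gram_ne_zero hQ hx hli' hspan' hw'
  have h := isSquare_det_wallForm_iff hx hli hspan hw
  rw [← quadraticChar_one_iff_isSquare h1, ← quadraticChar_one_iff_isSquare h2] at h
  rw [wallSign]
  rcases quadraticChar_dichotomy h1 with h3 | h3
  · rw [h3, h.2 h3]
  · rcases quadraticChar_dichotomy h2 with h4 | h4
    · rw [h4, h.1 h4]
    · rw [h3, h4]

theorem wallSign_sq (hQ : NonSingular Q) (hx : x ∈ O Q) : wallSign Q x * wallSign Q x = 1 := by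
  obtain ⟨w, v, hli, hspan, hw, -⟩ := exists_gram Q x
  rw [wallSign_eq hQ hx hli hspan hw, ← _root_.sq]
  exact quadraticChar_sq_one (det_gram_ne_zero hQ hx hli hspan hw)

theorem spinorNorm_eq_zero_iff (hF : ringChar F ≠ 2) (hQ : NonSingular Q) (hx : x ∈ O Q) :
    spinorNorm Q x = 0 ↔ wallSign Q x = 1 := by
  have hodd : ¬ Even (Nat.card F) := by
    rw [Nat.card_eq_fintype_card, Nat.not_even_iff, FiniteField.odd_card_of_char_ne_two hF]
  obtain ⟨w, v, hli, hspan, hw, -⟩ := exists_gram Q x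
  rw [wallSign_eq hQ hx hli hspan hw, quadraticChar_one_iff_isSquare
    (det_gram_ne_zero hQ hx hli hspan hw), ← isSquare_det_wallForm_iff hx hli hspan hw, spinorNorm,
    if_neg hodd]
  simp

theorem wallSign_one (hQ : NonSingular Q) : wallSign Q 1 = 1 := by
  have h : residual (1 : V ≃ₗ[F] V) = ⊥ := by
    rw [eq_bot_iff]
    rintro _ ⟨w, rfl⟩
    exact sub_self w
  rw [wallSign_eq (ι := Fin 0) (w := Fin.elim0) (v := Fin.elim0) hQ (one_mem _)
    linearIndependent_empty_type (by simp [h]) (fun i => i.elim0)]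
  simp

/-- Here the residual space of the product is V_y ⊕ ⟨u⟩, and in an adapted basis its Gram matrix is
block triangular with diagonal blocks the Gram matrix of y and Q(u). -/
theorem wallSign_refl_mul_of_notMem (hQ : NonSingular Q) {y : V ≃ₗ[F] V} (hy : y ∈ O Q) {u : V}
    (hu : Q u ≠ 0) (h : u ∉ residual y) :
    wallSign Q (refl Q hu * y) = quadraticChar F (Q u) * wallSign Q y := by
  obtain ⟨w, v, hli, hspan, hw, -⟩ := exists_gram Q y
  obtain ⟨w₁, hw₁, hne⟩ := exists_fixed_polar_ne_zero hQ hy h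
  -- A y-fixed vector scaled so that its pairing with u is Q(u); this makes it a preimage of u.
  set w₀ := (Q u * (polar Q w₁ u)⁻¹) • w₁ with hw₀
  have hfix : y w₀ = w₀ := by rw [hw₀, map_smul, hw₁]
  have hpol : polar Q w₀ u = Q u := by
    rw [hw₀, polar_smul_left, smul_eq_mul, mul_assoc, inv_mul_cancel₀ hne, mul_one]
  -- Subtracting a multiple of `w₀` cancels the u-component, so `w' i` is a preimage of the same `v
  -- i`.
  set w' := fun i => w i - ((Q u)⁻¹ * polar Q u (y (w i))) • w₀ with hw'
  have e0 : w₀ - (refl Q hu * y) w₀ = u := by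
    rw [sub_refl_mul_apply, hfix, polar_comm, hpol, inv_mul_cancel₀ hu, sub_self, one_smul,
      zero_add]
  have e1 : ∀ i, w' i - (refl Q hu * y) (w' i) = v i := by
    intro i
    have : w' i - (refl Q hu * y) (w' i) = (w i - (refl Q hu * y) (w i)) -
        ((Q u)⁻¹ * polar Q u (y (w i))) • (w₀ - (refl Q hu * y) w₀) := by
      simp only [hw', map_sub, map_smul, smul_sub]
      abel
    rw [this, e0, sub_refl_mul_apply, hw, add_sub_cancel_right]
  have hvmem : ∀ i, v i ∈ residual y := fun i => ⟨w i, hw i⟩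
  have hli' : LinearIndependent F (Sum.elim v (fun _ : Unit => u)) := by
    refine hli.sum_type ?_ ?_
    · rw [linearIndependent_unique_iff]
      rintro rfl
      exact h (zero_mem _)
    · rw [hspan, Set.range_const, Submodule.disjoint_span_singleton]
      intro h'
      exact absurd h' h
  have hspan' : Submodule.span F (Set.range (Sum.elim v (fun _ : Unit => u))) =
      residual (refl Q hu * y) := by
    apply le_antisymm
    · rw [Submodule.span_le]
      rintro _ ⟨i | i, rfl⟩
      · exact ⟨w' i, e1 i⟩
      · exact ⟨w₀, e0⟩
    · rintro _ ⟨z, rfl⟩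
      rw [oneSub_apply, sub_refl_mul_apply, Set.Sum.elim_range, Submodule.span_union, hspan]
      refine Submodule.add_mem_sup ⟨z, rfl⟩ (Submodule.smul_mem _ _ (Submodule.subset_span ?_))
      exact ⟨(), rfl⟩
  have hmem : refl Q hu * y ∈ O Q := mul_mem (refl_mem hu) hy
  have hblock : gram Q (Sum.elim w' fun _ : Unit => w₀) (Sum.elim v fun _ : Unit => u) =
      Matrix.fromBlocks (gram Q w v) (Matrix.of fun i _ => polar Q (w' i) u) 0
        (Matrix.of fun _ _ => Q u) := by
    ext i j
    rcases i with i | i <;> rcases j with j | j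
    · simp [gram, hw', polar_sub_left, polar_smul_left, polar_fixed_residual hy hfix (hvmem j)]
    · rfl
    · exact polar_fixed_residual hy hfix (hvmem j)
    · exact hpol
  rw [wallSign_eq hQ hmem hli' hspan' (w := Sum.elim w' (fun _ => w₀)) (by
    rintro (i | i)
    · exact e1 i
    · exact e0), wallSign_eq hQ hy hli hspan hw, hblock, Matrix.det_fromBlocks_zero₂₁, map_mul,
    mul_comm]
  simp

/-- If u = w − y w, then the product fixes w, and w pairs with u to Q(u) ≠ 0; so u is outside the
residual space of the product. The previous case applied to the product gives the claim, as the
reflection is an involution. -/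
theorem wallSign_refl_mul (hQ : NonSingular Q) {y : V ≃ₗ[F] V} (hy : y ∈ O Q) {u : V}
    (hu : Q u ≠ 0) : wallSign Q (refl Q hu * y) = quadraticChar F (Q u) * wallSign Q y := by
  by_cases h : u ∈ residual y
  swap
  · exact wallSign_refl_mul_of_notMem hQ hy hu h
  have hmem : refl Q hu * y ∈ O Q := mul_mem (refl_mem hu) hy
  have hnot : u ∉ residual (refl Q hu * y) := by
    obtain ⟨w, hw⟩ := h
    rw [oneSub_apply] at hw
    have hpol : polar Q u (y w) = - Q u := by
      have h1 : y w + u = w := by rw [← hw]; abel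
      have h2 : Q (y w + u) = Q w := by rw [h1]
      rw [map_add_polar, hy w] at h2
      rw [polar_comm]
      linear_combination h2
    have hfix : (refl Q hu * y) w = w := by
      have := sub_refl_mul_apply hu y w
      rw [hpol, hw, mul_neg, inv_mul_cancel₀ hu, neg_one_smul, add_neg_cancel] at this
      exact (sub_eq_zero.1 this).symm
    intro hcon
    have h3 := polar_fixed_residual hmem hfix hcon
    have h4 : polar Q w u = Q u := by
      have h1 : w = y w + u := by rw [← hw]; abel
      rw [h1, polar_add_left, polar_comm, hpol, polar_self_two]
      ring
    exact hu (h4 ▸ h3)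
  have h1 := wallSign_refl_mul_of_notMem hQ hmem hu hnot
  rw [← mul_assoc, refl_refl, one_mul] at h1
  rw [h1, ← mul_assoc, ← _root_.sq, quadraticChar_sq_one hu, one_mul]

theorem wallSign_refl (hQ : NonSingular Q) {u : V} (hu : Q u ≠ 0) :
    wallSign Q (refl Q hu) = quadraticChar F (Q u) := by
  have := wallSign_refl_mul hQ (one_mem (O Q)) hu
  rwa [mul_one, wallSign_one hQ, mul_one] at this

end Gram

/-! ### Generation by reflections and multiplicativity of the Wall sign -/

section Generation
variable {Q : QuadraticForm F V} [FiniteDimensional F V]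

/-- In odd characteristic the orthogonal group is generated by reflections. -/
theorem mem_closure_refl (h2 : (2 : F) ≠ 0) (hQ : NonSingular Q) {x : V ≃ₗ[F] V} (hx : x ∈ O Q) :
    x ∈ Submonoid.closure {r | ∃ (u : V) (hu : Q u ≠ 0), r = refl Q hu} := by
  classical
  set H := Submonoid.closure {r | ∃ (u : V) (hu : Q u ≠ 0), r = refl Q hu} with hH
  have hrefl : ∀ {u : V} (hu : Q u ≠ 0), refl Q hu ∈ H :=
    fun hu => Submonoid.subset_closure ⟨_, hu, rfl⟩
  let := invertibleOfNonzero h2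
  obtain ⟨b, hb⟩ := LinearMap.BilinForm.exists_orthogonal_basis (isSymm_polarBilin Q)
  have hb' : ∀ i j, i ≠ j → polar Q (b i) (b j) = 0 := fun i j hij => hb hij
  have hQb : ∀ i, Q (b i) ≠ 0 := by
    intro i h0
    have := LinearMap.BilinForm.iIsOrtho.not_isOrtho_basis_self_of_nondegenerate hb hQ i
    apply this
    change polar Q (b i) (b i) = 0
    rw [polar_self_two, h0, mul_zero]
  obtain ⟨k, hk⟩ : ∃ k, k = (Finset.univ.filter fun i => x (b i) ≠ b i).card := ⟨_, rfl⟩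
  induction k using Nat.strong_induction_on generalizing x with
  | _ k ih =>
  by_cases hall : ∀ i, x (b i) = b i
  · have : x = 1 := by
      apply LinearEquiv.toLinearMap_injective
      exact b.ext hall
    rw [this]
    exact one_mem _
  push Not at hall
  obtain ⟨i, hi⟩ := hall
  -- Induction on the number of moved vectors of an orthogonal basis: t returns `x (b i)` to `b i`
  -- without disturbing the basis vectors already fixed.
  suffices h : ∃ t ∈ H, t⁻¹ ∈ H ∧ t ∈ O Q ∧ t (x (b i)) = b i ∧
      ∀ j, x (b j) = b j → t (b j) = b j by
    obtain ⟨t, htH, htH', htO, hti, htj⟩ := h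
    have h1 := ih _ ?_ (mul_mem htO hx) rfl
    · have := mul_mem htH' h1
      rwa [inv_mul_cancel_left] at this
    · rw [hk]
      apply Finset.card_lt_card
      rw [Finset.ssubset_iff_of_subset]
      · exact ⟨i, Finset.mem_filter.2 ⟨Finset.mem_univ _, hi⟩, fun h => (Finset.mem_filter.1 h).2 hti⟩
      · intro j
        exact fun h => Finset.mem_filter.2 ⟨Finset.mem_univ _, fun h' =>
          (Finset.mem_filter.1 h).2 (by rw [LinearEquiv.mul_apply, h', htj j h'])⟩
  have hpolsame : ∀ j, x (b j) = b j → polar Q (b i) (b j) = 0 ∧ polar Q (x (b i)) (b j) = 0 := by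
    intro j hj
    have hij : i ≠ j := by rintro rfl; exact hi hj
    refine ⟨hb' i j hij, ?_⟩
    rw [← hj, polar_map hx, hb' i j hij]
  have hinv : ∀ {u : V} (hu : Q u ≠ 0), (refl Q hu)⁻¹ = refl Q hu :=
    fun hu => inv_eq_of_mul_eq_one_left (refl_refl hu)
  have hxi : Q (x (b i)) = Q (b i) := hx _
  have hsub : Q (b i - x (b i)) = 2 * Q (b i) - polar Q (b i) (x (b i)) := by
    rw [sub_eq_add_neg, map_add_polar, QuadraticMap.map_neg, polar_neg_right, hxi]; ring
  have hadd : Q (b i + x (b i)) = 2 * Q (b i) + polar Q (b i) (x (b i)) := by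
    rw [map_add_polar, hxi]; ring
  -- The values of Q at b ± x b add up to 4 Q(b) ≠ 0. Reflecting in b − x b sends x b to b;
  -- reflecting in b + x b sends it to −b, which the reflection in b corrects.
  by_cases h0 : Q (b i - x (b i)) = 0
  · have h1 : Q (b i + x (b i)) ≠ 0 := by
      intro h1
      have : 2 * (2 * Q (b i)) = 0 := by linear_combination h1 + h0 - hadd - hsub
      exact hQb i ((mul_eq_zero.1 ((mul_eq_zero.1 this).resolve_left h2)).resolve_left h2)
    refine ⟨refl Q (hQb i) * refl Q h1, mul_mem (hrefl _) (hrefl _), ?_,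
      mul_mem (refl_mem _) (refl_mem _), ?_, ?_⟩
    · rw [mul_inv_rev, hinv, hinv]
      exact mul_mem (hrefl _) (hrefl _)
    · have h3 : refl Q h1 (x (b i)) = - b i := by
        have : (Q (b i + x (b i)))⁻¹ * polar Q (b i + x (b i)) (x (b i)) = 1 := by
          rw [polar_add_left, polar_self_two, hxi, add_comm (polar Q _ _), ← hadd, inv_mul_cancel₀ h1]
        rw [refl_apply, this]
        module
      rw [LinearEquiv.mul_apply, h3, map_neg, refl_apply, polar_self_two]
      have : (Q (b i))⁻¹ * (2 * Q (b i)) = 2 := by field_simp [hQb i]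
      rw [this]
      module
    · intro j hj
      rw [LinearEquiv.mul_apply, refl_apply h1, polar_add_left, (hpolsame j hj).1,
        (hpolsame j hj).2, refl_apply]
      simp [(hpolsame j hj).1]
  · refine ⟨refl Q h0, hrefl _, by rw [hinv]; exact hrefl _, refl_mem _, ?_, ?_⟩
    · have : (Q (b i - x (b i)))⁻¹ * polar Q (b i - x (b i)) (x (b i)) = -1 := by
        have : polar Q (b i - x (b i)) (x (b i)) = - Q (b i - x (b i)) := by
          rw [polar_sub_left, polar_self_two, hxi, hsub]; ring
        rw [this, mul_neg, inv_mul_cancel₀ h0]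
      rw [refl_apply, this]
      module
    · intro j hj
      rw [refl_apply, polar_sub_left, (hpolsame j hj).1, (hpolsame j hj).2]
      simp

theorem wallSign_mul [Fintype F] [DecidableEq F] (h2 : (2 : F) ≠ 0) (hQ : NonSingular Q)
    {x y : V ≃ₗ[F] V} (hx : x ∈ O Q) (hy : y ∈ O Q) :
    wallSign Q (x * y) = wallSign Q x * wallSign Q y := by
  have hO : ∀ z ∈ Submonoid.closure {r | ∃ (u : V) (hu : Q u ≠ 0), r = refl Q hu}, z ∈ O Q := by
    intro z hz
    have : Submonoid.closure {r | ∃ (u : V) (hu : Q u ≠ 0), r = refl Q hu} ≤ (O Q).toSubmonoid := by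
      rw [Submonoid.closure_le]
      rintro _ ⟨u, hu, rfl⟩
      exact refl_mem hu
    exact this hz
  have := mem_closure_refl h2 hQ hx
  clear hx
  induction this using Submonoid.closure_induction generalizing y with
  | mem r hr =>
    obtain ⟨u, hu, rfl⟩ := hr
    rw [wallSign_refl_mul hQ hy, wallSign_refl hQ]
  | one => rw [one_mul, wallSign_one hQ, one_mul]
  | mul a b ha hb iha ihb =>
    rw [mul_assoc, iha (mul_mem (hO b hb) hy), ihb hy, iha (hO b hb), mul_assoc]

end Generation

end Reflections

/-! ### Additivity of the parity of the residual dimension -/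

section Parity

open QuadraticMap Module
variable {F V : Type*} [Field F] [AddCommGroup V] [Module F V]

/-- The form is non-degenerate on a complement of its kernel, so its rank is even. -/
theorem even_finrank_add_finrank_ker [FiniteDimensional F V] {ω : LinearMap.BilinForm F V} (hω : ω.IsAlt) :
    Even (finrank F V + finrank F (LinearMap.ker ω)) := by
  obtain ⟨C, hC⟩ := Submodule.exists_isCompl (LinearMap.ker ω)
  have hneg : ∀ a b, ω a b = 0 → ω b a = 0 := fun a b h => by
    rw [← neg_eq_zero, LinearMap.BilinForm.IsAlt.neg_eq hω, h]
  have hnd : (ω.restrict C).Nondegenerate := by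
    apply LinearMap.BilinForm.Nondegenerate.ofSeparatingLeft
    intro v hv
    have hv0 : (v : V) ∈ LinearMap.ker ω := by
      rw [LinearMap.mem_ker]
      ext u
      obtain ⟨k, hk, c, hc, rfl⟩ := Submodule.mem_sup.1
        (hC.sup_eq_top ▸ Submodule.mem_top : u ∈ LinearMap.ker ω ⊔ C)
      rw [map_add, hneg k v (by rw [LinearMap.mem_ker.1 hk]; rfl), zero_add]
      exact hv ⟨c, hc⟩
    exact Subtype.ext ((Submodule.disjoint_def.1 hC.disjoint) _ hv0 v.2)
  have h1 := even_finrank_of_isAlt (ω := ω.restrict C) (fun v => hω v) hnd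
  have h2 := Submodule.finrank_add_eq_of_isCompl hC
  rw [← h2]
  obtain ⟨m, hm⟩ := h1
  exact ⟨finrank F (LinearMap.ker ω) + m, by rw [hm]; ring⟩

theorem residual_inv (x : V ≃ₗ[F] V) : residual x⁻¹ = residual x := by
  have key : ∀ y : V ≃ₗ[F] V, residual y⁻¹ ≤ residual y := by
    rintro y _ ⟨w, rfl⟩
    refine ⟨- y⁻¹ w, ?_⟩
    rw [oneSub_apply, oneSub_apply, map_neg]
    have : y (y⁻¹ w) = w := by rw [← LinearEquiv.mul_apply, mul_inv_cancel]; rfl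
    rw [this]
    abel
  exact le_antisymm (key x) (by simpa using key x⁻¹)

theorem mem_fix {x : V ≃ₗ[F] V} {v : V} : v ∈ LinearMap.ker (oneSub x) ↔ x v = v := by
  rw [LinearMap.mem_ker, oneSub_apply, sub_eq_zero, eq_comm]

theorem fix_inv (x : V ≃ₗ[F] V) : LinearMap.ker (oneSub x⁻¹) = LinearMap.ker (oneSub x) := by
  ext v
  rw [mem_fix, mem_fix]
  constructor
  · intro h
    conv_lhs => rw [← h]
    rw [← LinearEquiv.mul_apply, mul_inv_cancel]; rfl
  · intro h
    conv_lhs => rw [← h]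
    rw [← LinearEquiv.mul_apply, inv_mul_cancel]; rfl

/-- The diagonal of every Wall form is Q itself; hence a difference of two Wall forms is alternating
in every characteristic. -/
theorem polar_eq_of_sub_eq {Q : QuadraticForm F V} {y : V ≃ₗ[F] V} (hy : y ∈ O Q) {w t : V}
    (h : w - y w = t) : polar Q w t = Q t := by
  have h1 : Q (w - y w) = Q w + Q (y w) - polar Q w (y w) := by
    rw [sub_eq_add_neg, map_add_polar, QuadraticMap.map_neg, polar_neg_right]; ring
  rw [← h, h1, polar_sub_right, polar_self_two, hy w]
  ring

/-- The parity of `dim V_x` is additive on the orthogonal group. -/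
theorem even_finrank_residual_mul [FiniteDimensional F V] {Q : QuadraticForm F V} (hQ : NonSingular Q) {x y : V ≃ₗ[F] V}
    (hx : x ∈ O Q) (hy : y ∈ O Q) :
    Even (finrank F (residual (x * y)) + (finrank F (residual x) + finrank F (residual y))) := by
  set K := residual y ⊓ residual x⁻¹ with hK
  have hx' : x⁻¹ ∈ O Q := inv_mem hx
  have hker : K = LinearMap.BilinForm.orthogonal (polarBilin Q)
      (LinearMap.ker (oneSub y) ⊔ LinearMap.ker (oneSub x⁻¹)) := by
    rw [hK, residual_eq_orthogonal hQ hy, residual_eq_orthogonal hQ hx']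
    ext v
    simp only [Submodule.mem_inf, LinearMap.BilinForm.mem_orthogonal_iff]
    constructor
    · rintro ⟨h1, h2⟩ w hw
      obtain ⟨a, ha, b, hb, rfl⟩ := Submodule.mem_sup.1 hw
      have e1 : polar Q a v = 0 := h1 a ha
      have e2 : polar Q b v = 0 := h2 b hb
      change polar Q (a + b) v = 0
      rw [polar_add_left, e1, e2, add_zero]
    · intro h
      exact ⟨fun w hw => h w (Submodule.mem_sup_left hw), fun w hw => h w (Submodule.mem_sup_right hw)⟩
  let d : K →ₗ[F] V := preimage y ∘ₗ Submodule.inclusion inf_le_left -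
    preimage x⁻¹ ∘ₗ Submodule.inclusion inf_le_right
  have hd : ∀ t : K, ∃ w w', w - y w = t ∧ w' - x⁻¹ w' = t ∧ d t = w - w' := fun t =>
    ⟨_, _, preimage_spec y ⟨t, t.2.1⟩, preimage_spec x⁻¹ ⟨t, t.2.2⟩, rfl⟩
  -- The Wall form of y minus that of x⁻¹, both restricted to K.
  let f : LinearMap.BilinForm F K := ((polarBilin Q).comp d).compl₂ K.subtype
  have hf : ∀ t s : K, f t s = polar Q (d t) s := fun _ _ => rfl
  have halt : f.IsAlt := by
    intro t
    obtain ⟨w, w', h1, h2, h3⟩ := hd t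
    rw [hf, h3, polar_sub_left, polar_eq_of_sub_eq hy h1, polar_eq_of_sub_eq hx' h2, sub_self]
  have hfix : ∀ v : LinearMap.ker (oneSub (x * y)), y v = x⁻¹ v := by
    intro v
    have := mem_fix.1 v.2
    conv_rhs => rw [← this]
    rw [← LinearEquiv.mul_apply, inv_mul_cancel_left]
  let φ : LinearMap.ker (oneSub (x * y)) →ₗ[F] K :=
    ((oneSub y).domRestrict _).codRestrict K (fun v => ⟨⟨v, rfl⟩, ⟨v, by
      rw [LinearMap.domRestrict_apply, oneSub_apply, oneSub_apply, hfix]⟩⟩)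
  have hφ : ∀ v, (φ v : V) = v - y v := fun _ => rfl
  -- On the fixed space of xy the maps y and x⁻¹ agree, so 1 − y sends it into the kernel of f.
  -- Conversely, if f kills t, the two preimages of t differ by a sum of a y-fixed and an x⁻¹-fixed
  -- vector; correcting by these gives a common preimage, fixed by xy.
  have hrange : LinearMap.range φ = LinearMap.ker f := by
    ext t
    rw [LinearMap.mem_ker]
    obtain ⟨w, w', h1, h2, h3⟩ := hd t
    constructor
    · rintro ⟨v, hv⟩
      have hv' : (v : V) - y v = t := by rw [← hφ, hv]
      have hv'' : (v : V) - x⁻¹ v = t := by rw [← hfix, hv']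
      ext s
      have e1 : y (w - v) = w - v := by
        rw [map_sub]
        have : w - v - (y w - y v) = 0 := by rw [sub_sub_sub_comm, h1, hv', sub_self]
        exact (sub_eq_zero.1 this).symm
      have e2 : x⁻¹ (w' - v) = w' - v := by
        rw [map_sub]
        have : w' - v - (x⁻¹ w' - x⁻¹ v) = 0 := by rw [sub_sub_sub_comm, h2, hv'', sub_self]
        exact (sub_eq_zero.1 this).symm
      have : d t = (w - v) - (w' - v) := by rw [h3]; abel
      rw [hf, this, polar_sub_left, polar_fixed_residual hy e1 s.2.1,
        polar_fixed_residual hx' e2 s.2.2, sub_zero]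
      rfl
    · intro h0
      have hmem : d t ∈ LinearMap.ker (oneSub y) ⊔ LinearMap.ker (oneSub x⁻¹) := by
        rw [← LinearMap.BilinForm.orthogonal_orthogonal hQ (isRefl_polarBilin Q)
          (LinearMap.ker (oneSub y) ⊔ LinearMap.ker (oneSub x⁻¹)), ← hker,
          LinearMap.BilinForm.mem_orthogonal_iff]
        intro s hs
        change polar Q s (d t) = 0
        rw [polar_comm]
        exact LinearMap.congr_fun h0 ⟨s, hs⟩
      obtain ⟨a, ha, b, hb, hab⟩ := Submodule.mem_sup.1 hmem
      rw [mem_fix] at ha hb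
      have e1 : w - a - y (w - a) = t := by rw [map_sub, ha, ← h1]; abel
      have e2 : w - a - x⁻¹ (w - a) = t := by
        have : w - a = w' + b := by
          have : a + b = w - w' := by rw [hab, h3]
          rw [sub_eq_iff_eq_add, add_assoc, add_comm b, this]; abel
        rw [this, map_add, hb, ← h2]; abel
      refine ⟨⟨w - a, ?_⟩, Subtype.ext e1⟩
      rw [mem_fix, LinearEquiv.mul_apply]
      have : y (w - a) = x⁻¹ (w - a) := by
        rw [← sub_right_inj, e1, e2]
      rw [this, ← LinearEquiv.mul_apply, mul_inv_cancel]; rfl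
  have hkerφ : finrank F (LinearMap.ker φ) =
      finrank F (LinearMap.ker (oneSub y) ⊓ LinearMap.ker (oneSub x⁻¹) : Submodule F V) := by
    have hmap : (LinearMap.ker φ).map (LinearMap.ker (oneSub (x * y))).subtype =
        LinearMap.ker (oneSub y) ⊓ LinearMap.ker (oneSub x⁻¹) := by
      ext v
      rw [fix_inv, Submodule.mem_inf, mem_fix, mem_fix]
      constructor
      · rintro ⟨v, hv, rfl⟩
        have h1 : (v : V) - y v = 0 := by
          rw [← hφ, LinearMap.mem_ker.1 hv]; rfl
        have h2 : y v = v := (sub_eq_zero.1 h1).symm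
        refine ⟨h2, ?_⟩
        have := mem_fix.1 v.2
        rwa [LinearEquiv.mul_apply, h2] at this
      · rintro ⟨h1, h2⟩
        refine ⟨⟨v, mem_fix.2 (by rw [LinearEquiv.mul_apply, h1, h2])⟩, ?_, rfl⟩
        refine LinearMap.mem_ker.2 (Subtype.ext ?_)
        change v - y v = 0
        rw [h1, sub_self]
    rw [← hmap]
    exact (LinearEquiv.finrank_eq (Submodule.equivSubtypeMap _ _))
  have d1 := LinearMap.finrank_range_add_finrank_ker φ
  rw [hrange, hkerφ] at d1
  have d2 := Submodule.finrank_sup_add_finrank_inf_eq (LinearMap.ker (oneSub y))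
    (LinearMap.ker (oneSub x⁻¹))
  have d3 := LinearMap.BilinForm.finrank_orthogonal hQ
    (LinearMap.ker (oneSub y) ⊔ LinearMap.ker (oneSub x⁻¹))
  rw [← hker] at d3
  have d4 := Submodule.finrank_le (LinearMap.ker (oneSub y) ⊔ LinearMap.ker (oneSub x⁻¹))
  have d5 : finrank F (residual (x * y)) + _ = _ :=
    LinearMap.finrank_range_add_finrank_ker (oneSub (x * y))
  have d6 : finrank F (residual y) + _ = _ := LinearMap.finrank_range_add_finrank_ker (oneSub y)
  have d7 : finrank F (residual x⁻¹) + _ = _ :=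
    LinearMap.finrank_range_add_finrank_ker (oneSub x⁻¹)
  rw [residual_inv] at d7
  -- With dim K + dim ker f = 2m, the formulas above combine to dim V_{xy} = dim V_x + dim V_y − 2m.
  obtain ⟨m, hm⟩ := even_finrank_add_finrank_ker halt
  exact ⟨finrank F (residual x) + finrank F (residual y) - m, by omega⟩

theorem finrank_residual_refl {Q : QuadraticForm F V} (hQ : NonSingular Q) {u : V} (hu : Q u ≠ 0) :
    finrank F (residual (refl Q hu)) = 1 := by
  have h : residual (refl Q hu) = Submodule.span F {u} := by
    apply le_antisymm
    · rintro _ ⟨w, rfl⟩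
      rw [oneSub_apply, refl_apply, sub_sub_cancel]
      exact Submodule.smul_mem _ _ (Submodule.mem_span_singleton_self u)
    · rw [Submodule.span_singleton_le_iff_mem]
      have : ∃ w, polar Q u w ≠ 0 := by
        by_contra! h
        rw [eq_zero_of_polar hQ h, QuadraticMap.map_zero] at hu
        exact hu rfl
      obtain ⟨w, hw⟩ := this
      refine ⟨(Q u * (polar Q u w)⁻¹) • w, ?_⟩
      rw [oneSub_apply, refl_apply, sub_sub_cancel, polar_smul_right, smul_eq_mul]
      have : (Q u)⁻¹ * (Q u * (polar Q u w)⁻¹ * polar Q u w) = 1 := by field_simp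
      rw [this, one_smul]
  rw [h]
  apply finrank_span_singleton
  rintro rfl
  exact hu (QuadraticMap.map_zero Q)

end Parity

/-! ### Centralizers in characteristic two -/

section CommutingParity

open QuadraticMap Module Polynomial
variable {F V : Type*} [Field F] [AddCommGroup V] [Module F V]

/-- In characteristic two, an isometry of a non-degenerate bilinear form in odd dimension has
the eigenvalue `1`. -/
theorem even_card_of_isometry [CharP F 2] {ι : Type*} [Fintype ι] [DecidableEq ι]
    {A Y : Matrix ι ι F} (hA : A.det ≠ 0) (hY : Y.transpose * A * Y = A) (h1 : (1 - Y).det ≠ 0) :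
    Even (Fintype.card ι) := by
  have hneg : ∀ a : F, a + a = 0 := CharTwo.add_self_eq_zero
  set p := Y.charpoly with hp
  have hYdet : IsUnit Y.det := by
    have h := congrArg Matrix.det hY
    rw [Matrix.det_mul, Matrix.det_mul, Matrix.det_transpose] at h
    refine isUnit_iff_ne_zero.2 fun h0 => hA ?_
    rw [← h, h0, mul_zero]
  have hAunit : IsUnit A := (Matrix.isUnit_iff_isUnit_det _).2 hA.isUnit
  have hYunit : IsUnit Y := (Matrix.isUnit_iff_isUnit_det _).2 hYdet
  -- Y is conjugate under A to its inverse transpose, so its characteristic polynomial is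
  -- proportional to its reverse.
  obtain ⟨c, hrev⟩ : ∃ c, p = C c * p.reverse := by
    have hconj : Y = (↑hAunit.unit⁻¹ : Matrix ι ι F) * Y⁻¹.transpose * hAunit.unit.val := by
      rw [mul_assoc, Units.eq_inv_mul_iff_mul_eq, IsUnit.unit_spec]
      have hT : Y⁻¹.transpose * Y.transpose = 1 := by
        rw [← Matrix.transpose_mul, Matrix.mul_nonsing_inv _ hYdet, Matrix.transpose_one]
      conv_rhs => rw [← hY]
      rw [mul_assoc Y.transpose, ← mul_assoc, hT, one_mul]
    rw [Matrix.coe_units_inv] at hconj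
    have h := Matrix.charpoly_units_conj' hAunit.unit Y⁻¹.transpose
    rw [← hconj, Matrix.charpoly_transpose, Matrix.charpoly_inv Y hYunit] at h
    refine ⟨(-1) ^ Fintype.card ι * Ring.inverse Y.det, ?_⟩
    rw [hp, Matrix.reverse_charpoly, h]
    simp
  have hp1 : p.eval 1 = (1 - Y).det := by
    rw [hp, Matrix.eval_charpoly]; simp
  have hr1 : p.reverse.eval 1 = p.eval 1 := by
    let : Invertible (1 : F) := invertibleOne
    have := eval₂_reverse_mul_pow (RingHom.id F) 1 p
    simpa [eval₂_id] using this
  -- A polynomial and its reverse agree at 1, and here the value is nonzero.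
  have hc : c = 1 := by
    have := congrArg (eval 1) hrev
    rw [eval_mul, eval_C, hr1, hp1] at this
    exact (mul_right_cancel₀ h1 (((one_mul _).trans this))).symm
  rw [hc, C_1, one_mul] at hrev
  have hdeg : p.natDegree = Fintype.card ι := Matrix.charpoly_natDegree_eq_dim Y
  by_contra hodd
  apply h1
  rw [← hp1, eval_eq_sum_range, hdeg]
  -- In odd degree d the coefficients at i and d − i are equal and paired without a fixed index, so
  -- the value at 1 cancels.
  refine Finset.sum_involution (fun i _ => Fintype.card ι - i) ?_ ?_ ?_ ?_
  · intro i hi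
    have hi' : i ≤ p.natDegree := by rw [hdeg]; simpa [Nat.lt_succ_iff] using hi
    have : p.coeff (Fintype.card ι - i) = p.coeff i := by
      conv_rhs => rw [hrev, coeff_reverse, revAt_le hi', hdeg]
    rw [this, one_pow, one_pow, mul_one, hneg]
  · intro i hi _ h
    apply hodd
    have := Finset.mem_range.1 hi
    exact ⟨i, by omega⟩
  · intro i hi
    exact Finset.mem_range.2 (by omega)
  · intro i hi
    have := Finset.mem_range.1 hi
    omega

/-- In characteristic two, if the isometry `x` has no non-zero fixed vector, then `V_g` has even
dimension for every isometry `g` commuting with `x`. -/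
theorem even_finrank_residual_of_commute [CharP F 2] [FiniteDimensional F V]
    {Q : QuadraticForm F V} (hQ : NonSingular Q) {x g : V ≃ₗ[F] V} (hx : x ∈ O Q) (hg : g ∈ O Q)
    (hxg : Commute x g) (hfix : ∀ v, x v = v → v = 0) : Even (finrank F (residual g)) := by
  have hcomm : ∀ v, x (g v) = g (x v) := fun v => LinearEquiv.congr_fun hxg v
  have hmaps : ∀ u ∈ residual g, (x : V →ₗ[F] V) u ∈ residual g := by
    rintro _ ⟨w, rfl⟩
    exact ⟨x w, by simp [oneSub_apply, hcomm]⟩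
  let y : residual g →ₗ[F] residual g := (x : V →ₗ[F] V).restrict hmaps
  have hy : ∀ u, (y u : V) = x u := fun _ => rfl
  let b := finBasis F (residual g)
  obtain ⟨w, v, hli, hspan, hw, h⟩ := exists_gram Q g
  have hA := det_gram_ne_zero hQ hg hli hspan hw
  rw [← h] at hA
  rw [← Fintype.card_fin (finrank F (residual g))]
  refine even_card_of_isometry hA (Y := LinearMap.toMatrix b b y) ?_ ?_
  · rw [← LinearMap.BilinForm.toMatrix_comp]
    congr 1
    ext u v
    rw [LinearMap.BilinForm.comp_apply,
      wallForm_eq Q g hg (y u) (y v) (x (preimage g u)) (by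
        rw [← hcomm, ← map_sub, preimage_spec, hy]), hy, polar_map hx]
    rfl
  · rw [← LinearMap.toMatrix_one b, ← map_sub, LinearMap.det_toMatrix]
    intro h0
    obtain ⟨u, hu, hu0⟩ := (Submodule.ne_bot_iff _).1
      ((LinearMap.bot_lt_ker_of_det_eq_zero h0).ne')
    apply hu0
    apply Subtype.ext
    apply hfix
    have : u - y u = 0 := hu
    rw [← hy, ← sub_eq_zero.1 this]

end CommutingParity

/-! ### The spinor norm as a homomorphism, class splitting, and semisimplicity -/

section Splitting

open QuadraticMap Module Polynomial
variable {F V : Type*} [Field F] [AddCommGroup V] [Module F V]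

theorem zmod_two_eq_one {a : ZMod 2} (h : a ≠ 0) : a = 1 := by
  revert a; decide

/-- The spinor norm is a homomorphism. -/
theorem spinorNorm_mul [Finite F] [FiniteDimensional F V] {Q : QuadraticForm F V}
    (hQ : NonSingular Q) {x y : V ≃ₗ[F] V} (hx : x ∈ O Q) (hy : y ∈ O Q) :
    spinorNorm Q (x * y) = spinorNorm Q x + spinorNorm Q y := by
  classical
  let := Fintype.ofFinite F
  by_cases hF : ringChar F = 2
  · have heven : Even (Nat.card F) := by
      rw [Nat.card_eq_fintype_card, Nat.even_iff, ← FiniteField.even_card_iff_char_two, hF]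
    simp only [spinorNorm, if_pos heven]
    rw [← sub_eq_zero, CharTwo.sub_eq_add]
    have := even_finrank_residual_mul hQ hx hy
    exact_mod_cast (ZMod.natCast_eq_zero_iff_even).2 this
  · have h2 : (2 : F) ≠ 0 := Ring.two_ne_zero hF
    have h := wallSign_mul h2 hQ hx hy
    have sq : ∀ {z : V ≃ₗ[F] V}, z ∈ O Q → spinorNorm Q z = 0 ∧ wallSign Q z = 1 ∨
        spinorNorm Q z = 1 ∧ wallSign Q z = -1 := by
      intro z hz
      have h0 := spinorNorm_eq_zero_iff hF hQ hz
      rcases mul_self_eq_one_iff.1 (wallSign_sq hQ hz) with h1 | h1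
      · exact Or.inl ⟨h0.2 h1, h1⟩
      · refine Or.inr ⟨zmod_two_eq_one fun h => ?_, h1⟩
        rw [h0.1 h] at h1
        norm_num at h1
    rcases sq hx with ⟨h1, h2⟩ | ⟨h1, h2⟩ <;> rcases sq hy with ⟨h3, h4⟩ | ⟨h3, h4⟩ <;>
      rcases sq (mul_mem hx hy) with ⟨h5, h6⟩ | ⟨h5, h6⟩ <;>
      rw [h2, h4, h6] at h <;> norm_num at h <;> rw [h1, h3, h5] <;> decide

theorem spinorNorm_one [Finite F] [FiniteDimensional F V] {Q : QuadraticForm F V}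
    (hQ : NonSingular Q) : spinorNorm Q (1 : V ≃ₗ[F] V) = 0 := by
  have := spinorNorm_mul hQ (one_mem (O Q)) (one_mem (O Q))
  rwa [one_mul, left_eq_add] at this

theorem spinorNorm_inv [Finite F] [FiniteDimensional F V] {Q : QuadraticForm F V}
    (hQ : NonSingular Q) {x : V ≃ₗ[F] V} (hx : x ∈ O Q) : spinorNorm Q x⁻¹ = spinorNorm Q x := by
  have := spinorNorm_mul hQ (inv_mem hx) hx
  rw [inv_mul_cancel, spinorNorm_one hQ, eq_comm, ← CharTwo.sub_eq_add, sub_eq_zero] at this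
  exact this

/-- If some element of `SO` outside `Omega` commutes with `x`, the classes of `x` under `Omega`
and `SO` coincide. -/
theorem conjClass_eq_of_commute [Finite F] [FiniteDimensional F V] {Q : QuadraticForm F V}
    (hQ : NonSingular Q) {x c : V ≃ₗ[F] V} (hc : c ∈ SO Q) (hθ : spinorNorm Q c = 1)
    (hxc : Commute x c) :
    conjClass (Omega Q) x = conjClass (SO Q : Set (V ≃ₗ[F] V)) x := by
  apply Set.Subset.antisymm
  · rintro _ ⟨g, hg, rfl⟩
    exact ⟨g, hg.1, rfl⟩
  · rintro _ ⟨g, hg, rfl⟩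
    by_cases h : spinorNorm Q g = 0
    · exact ⟨g, ⟨hg, h⟩, rfl⟩
    · refine ⟨c * g, ⟨mul_mem hc hg, ?_⟩, ?_⟩
      · rw [spinorNorm_mul hQ hc.1 hg.1, hθ, zmod_two_eq_one h]
        decide
      · rw [mul_inv_rev, mul_assoc, mul_assoc, ← mul_assoc x, hxc.eq]
        simp only [← mul_assoc, inv_mul_cancel_right]

/-- If `Omega` contains the centralizer of `x` in `SO`, the class of `x` under `SO` splits. -/
theorem conjClass_split [Finite F] [FiniteDimensional F V] {Q : QuadraticForm F V}
    (hQ : NonSingular Q) {x z : V ≃ₗ[F] V} (hx : x ∈ Omega Q) (hz : z ∈ SO Q) (hzΩ : z ∉ Omega Q)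
    (hcent : ∀ g ∈ SO Q, Commute x g → spinorNorm Q g = 0) :
    z⁻¹ * x * z ∈ Omega Q ∧
      conjClass (SO Q : Set (V ≃ₗ[F] V)) x =
        conjClass (Omega Q) x ∪ conjClass (Omega Q) (z⁻¹ * x * z) ∧
      Disjoint (conjClass (Omega Q) x) (conjClass (Omega Q) (z⁻¹ * x * z)) := by
  have hθz : spinorNorm Q z = 1 := zmod_two_eq_one fun h => hzΩ ⟨hz, h⟩
  refine ⟨⟨mul_mem (mul_mem (inv_mem hz) hx.1) hz, ?_⟩, ?_, ?_⟩
  · rw [spinorNorm_mul hQ (mul_mem (inv_mem hz.1) hx.1.1) hz.1, spinorNorm_mul hQ (inv_mem hz.1) hx.1.1,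
      spinorNorm_inv hQ hz.1, hx.2, hθz]
    decide
  · apply Set.Subset.antisymm
    · rintro _ ⟨g, hg, rfl⟩
      by_cases h : spinorNorm Q g = 0
      · exact Or.inl ⟨g, ⟨hg, h⟩, rfl⟩
      · refine Or.inr ⟨z⁻¹ * g, ⟨mul_mem (inv_mem hz) hg, ?_⟩, by group⟩
        rw [spinorNorm_mul hQ (inv_mem hz.1) hg.1, spinorNorm_inv hQ hz.1, hθz, zmod_two_eq_one h]
        decide
    · rintro _ (⟨g, hg, rfl⟩ | ⟨g, hg, rfl⟩)
      · exact ⟨g, hg.1, rfl⟩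
      · exact ⟨z * g, mul_mem hz hg.1, by group⟩
  · rw [Set.disjoint_left]
    rintro _ ⟨g, hg, rfl⟩ ⟨h, hh, he⟩
    -- A common element of both classes gives a centralizing element whose spinor norm is that of z,
    -- namely 1.
    have hc : Commute x (z * h * g⁻¹) := by
      have h1 : x = g * (h⁻¹ * (z⁻¹ * x * z) * h) * g⁻¹ := by rw [← he]; group
      change x * _ = _ * x
      calc x * (z * h * g⁻¹) = z * h * g⁻¹ * (g * (h⁻¹ * (z⁻¹ * x * z) * h) * g⁻¹) := by group
        _ = _ := by rw [← h1]
    have := hcent _ (mul_mem (mul_mem hz hh.1) (inv_mem hg.1)) hc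
    rw [spinorNorm_mul hQ (mul_mem hz.1 hh.1.1) (inv_mem hg.1.1), spinorNorm_mul hQ hz.1 hh.1.1,
      spinorNorm_inv hQ hg.1.1, hg.2, hh.2, hθz] at this
    exact absurd this (by decide)

/-- With m the order of x, X^m − 1 annihilates x and is separable because m ≠ 0 in F. Coprimality
also excludes infinite order, where `orderOf x = 0`. -/
theorem isSemisimple_of_semisimple [Finite F] {x : V ≃ₗ[F] V} (hss : Semisimple x) :
    Module.End.IsSemisimple (x : Module.End F V) := by
  have hm : (orderOf x : F) ≠ 0 := by
    intro h
    have h1 := (ringChar.spec F _).1 h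
    have h2 : ringChar F = 1 := Nat.eq_one_of_dvd_coprimes hss h1 dvd_rfl
    have h3 := ringChar.charP F
    rw [h2] at h3
    exact CharP.char_ne_one F 1 rfl
  refine Module.End.isSemisimple_of_squarefree_aeval_eq_zero (p := X ^ orderOf x - 1)
    (X_pow_sub_one_separable_iff.2 hm).squarefree ?_
  have hpow : ∀ k : ℕ, ((x : Module.End F V)) ^ k = ((x ^ k : V ≃ₗ[F] V) : Module.End F V) := by
    intro k
    induction k with
    | zero => rfl
    | succ k ih => rw [pow_succ, ih, pow_succ]; rfl
  rw [map_sub, map_pow, aeval_X, map_one, hpow, pow_orderOf_eq_one]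
  exact sub_self _

/-- The kernel has an invariant complement C, and f maps V into C; so kernel and range meet
trivially. -/
theorem ker_disjoint_range_of_isSemisimple {f : Module.End F V} (hf : f.IsSemisimple) {v : V}
    (h : f (f v) = 0) : f v = 0 := by
  obtain ⟨C, hC, hcompl⟩ := Module.End.isSemisimple_iff.1 hf (LinearMap.ker f) (by
    intro a ha
    rw [Submodule.mem_comap, LinearMap.mem_ker, LinearMap.mem_ker.1 ha, map_zero])
  obtain ⟨k, hk, c, hc, rfl⟩ := Submodule.mem_sup.1
    (hcompl.sup_eq_top ▸ Submodule.mem_top : v ∈ LinearMap.ker f ⊔ C)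
  rw [map_add, LinearMap.mem_ker.1 hk, zero_add] at h ⊢
  exact Submodule.disjoint_def.1 hcompl.disjoint _ h (hC hc)

/-- The fixed space of a semisimple isometry is non-degenerate. -/
theorem exists_fixed_of_isSemisimple [FiniteDimensional F V] {Q : QuadraticForm F V}
    (hQ : NonSingular Q) {x : V ≃ₗ[F] V} (hx : x ∈ O Q) (hss : Module.End.IsSemisimple (x : Module.End F V))
    {v : V} (hv : x v = v) (hv0 : v ≠ 0) : ∃ w, x w = w ∧ polar Q v w ≠ 0 := by
  have hmem : v ∉ residual x := by
    intro h
    obtain ⟨w, hw⟩ := h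
    have hsub : Module.End.IsSemisimple (oneSub x) := by
      have h1 : oneSub x = -((x : Module.End F V) - algebraMap F (Module.End F V) 1) := by
        rw [map_one, neg_sub]; rfl
      rw [h1, Module.End.isSemisimple_neg, Module.End.isSemisimple_sub_algebraMap_iff]
      exact hss
    have := ker_disjoint_range_of_isSemisimple hsub (v := w) (by
      rw [hw, oneSub_apply, hv, sub_self])
    exact hv0 (hw ▸ this)
  obtain ⟨w, hw, h⟩ := exists_fixed_polar_ne_zero hQ hx hmem
  exact ⟨w, hw, by rwa [polar_comm]⟩

/-- Comparing Gram determinants, det x squares to 1, and 1 = −1. -/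
theorem det_eq_one_of_charTwo [CharP F 2] [FiniteDimensional F V] {Q : QuadraticForm F V}
    (hQ : NonSingular Q) {x : V ≃ₗ[F] V} (hx : x ∈ O Q) : x ∈ SO Q := by
  refine ⟨hx, ?_⟩
  change LinearEquiv.det x = 1
  ext
  rw [LinearEquiv.coe_det, Units.val_one]
  let b := finBasis F V
  have h2 : LinearMap.BilinForm.comp (polarBilin Q) (x : V →ₗ[F] V) (x : V →ₗ[F] V) =
      polarBilin Q := by
    ext u v
    exact polar_map hx u v
  have h3 := congrArg (fun B => (LinearMap.BilinForm.toMatrix b B).det) h2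
  simp only [LinearMap.BilinForm.toMatrix_comp b, Matrix.det_mul, Matrix.det_transpose,
    LinearMap.det_toMatrix] at h3
  have h4 := (LinearMap.BilinForm.nondegenerate_iff_det_ne_zero b).1 hQ
  have h5 : LinearMap.det (x : V →ₗ[F] V) * LinearMap.det (x : V →ₗ[F] V) = 1 := by
    apply mul_right_cancel₀ h4
    rw [one_mul]
    conv_rhs => rw [← h3]
    ring
  rcases mul_self_eq_one_iff.1 h5 with h | h
  · exact h
  · rw [h, CharTwo.neg_eq]

theorem exists_anisotropic {Q : QuadraticForm F V} {v w : V} (h : polar Q v w ≠ 0) :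
    Q v ≠ 0 ∨ Q w ≠ 0 ∨ Q (v + w) ≠ 0 := by
  by_contra! hcon
  exact h (by rw [polar, hcon.1, hcon.2.1, hcon.2.2]; simp)

theorem spinorNorm_refl_charTwo [CharP F 2] [Finite F] [FiniteDimensional F V]
    {Q : QuadraticForm F V} (hQ : NonSingular Q) (heven : Even (Nat.card F)) {u : V} (hu : Q u ≠ 0) :
    spinorNorm Q (refl Q hu) = 1 := by
  rw [spinorNorm, if_pos heven, finrank_residual_refl hQ hu, Nat.cast_one]

theorem isUnit_add_one_iff [CharP F 2] [FiniteDimensional F V] (x : V ≃ₗ[F] V) :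
    IsUnit ((x : Module.End F V) + 1) ↔ ∀ v, x v = v → v = 0 := by
  have hadd : ∀ v, ((x : Module.End F V) + 1) v = 0 ↔ x v = v := by
    intro v
    change x v + v = 0 ↔ _
    have : v = -v := by
      rw [eq_neg_iff_add_eq_zero, ← two_smul F, CharTwo.two_eq_zero, zero_smul]
    conv_lhs => rw [this, map_neg, ← sub_eq_add_neg, sub_eq_zero, neg_eq_iff_eq_neg, ← this]
  rw [LinearMap.isUnit_iff_ker_eq_bot, LinearMap.ker_eq_bot']
  simp only [hadd]

end Splitting

/-! ### Commuting elements of spinor norm one in odd characteristic -/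

section AdjointPairs

open QuadraticMap Module Polynomial
variable {F V : Type*} [Field F] [AddCommGroup V] [Module F V]

/-- A non-degenerate plane over a finite field of odd characteristic contains two anisotropic
vectors whose values differ by a non-square. -/
theorem exists_not_isSquare_mul [Finite F] [FiniteDimensional F V] (hF : ringChar F ≠ 2)
    {Q : QuadraticForm F V} (W : Submodule F V) (hdim : 2 ≤ finrank F W)
    (hW : ∀ v ∈ W, (∀ w ∈ W, polar Q v w = 0) → v = 0) :
    ∃ u ∈ W, ∃ v ∈ W, Q u ≠ 0 ∧ Q v ≠ 0 ∧ ¬ IsSquare (Q u * Q v) := by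
  have h2 : (2 : F) ≠ 0 := Ring.two_ne_zero hF
  let := invertibleOfNonzero h2
  let := Fintype.ofFinite F
  let B : LinearMap.BilinForm F W := LinearMap.BilinForm.restrict (polarBilin Q) W
  have hBsymm : LinearMap.IsSymm B := ⟨fun a b => polar_comm Q a b⟩
  have hnd : B.Nondegenerate := by
    apply LinearMap.BilinForm.Nondegenerate.ofSeparatingLeft
    intro v hv
    exact Subtype.ext (hW v v.2 fun w hw => hv ⟨w, hw⟩)
  obtain ⟨b, hb⟩ := LinearMap.BilinForm.exists_orthogonal_basis (B := B) hBsymm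
  have hQb : ∀ i, Q (b i : V) ≠ 0 := by
    intro i h0
    apply LinearMap.BilinForm.iIsOrtho.not_isOrtho_basis_self_of_nondegenerate (B := B) hb hnd i
    change polar Q (b i : V) (b i : V) = 0
    rw [polar_self_two, h0, mul_zero]
  let i₀ : Fin (finrank F W) := ⟨0, by omega⟩
  let i₁ : Fin (finrank F W) := ⟨1, by omega⟩
  have hort : polar Q (b i₀ : V) (b i₁ : V) = 0 := hb (by simp [i₀, i₁] : i₀ ≠ i₁)
  obtain ⟨ν, hν⟩ := FiniteField.exists_nonsquare hF
  have hν0 : ν ≠ 0 := by rintro rfl; exact hν (IsSquare.zero)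
  set α := Q (b i₀ : V) with hα
  set γ := Q (b i₁ : V) with hγ
  -- Solves α s² + γ t² = α ν, always possible over a finite field of odd order. The product of the
  -- two values is then α² ν.
  obtain ⟨s, t, hst⟩ := FiniteField.exists_root_sum_quadratic
    (f := C α * X ^ 2) (g := C γ * X ^ 2 - C (α * ν))
    (degree_C_mul_X_pow 2 (hQb i₀)) (by
      have hlt : degree (C (α * ν)) < degree (C γ * X ^ 2) := by
        rw [degree_C_mul_X_pow 2 (hQb i₁)]
        exact lt_of_le_of_lt degree_C_le (by norm_num)
      rw [degree_sub_eq_left_of_degree_lt hlt, degree_C_mul_X_pow 2 (hQb i₁)]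
      rfl)
    (FiniteField.odd_card_of_char_ne_two hF)
  have hval : Q (s • (b i₀ : V) + t • (b i₁ : V)) = α * ν := by
    rw [map_add_polar, QuadraticMap.map_smul, QuadraticMap.map_smul, polar_smul_left,
      polar_smul_right, hort, ← hα, ← hγ]
    simp only [eval_mul, eval_C, eval_pow, eval_X, eval_sub] at hst
    simp only [smul_eq_mul]
    linear_combination hst
  refine ⟨b i₀, (b i₀).2, _, W.add_mem (W.smul_mem s (b i₀).2) (W.smul_mem t (b i₁).2),
    hQb i₀, ?_, ?_⟩
  · rw [hval]
    exact mul_ne_zero (hQb i₀) hν0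
  · rw [hval, ← hα]
    rintro ⟨r, hr⟩
    have hα0 : α ≠ 0 := hQb i₀
    exact hν ⟨r / α, by field_simp; linear_combination hr⟩

theorem spinorNorm_eq_one_of_gram [Finite F] [FiniteDimensional F V] (hF : ringChar F ≠ 2)
    {Q : QuadraticForm F V} {x : V ≃ₗ[F] V} {ι : Type*} [Fintype ι] [DecidableEq ι]
    (hx : x ∈ O Q) {w v : ι → V} (hli : LinearIndependent F v)
    (hspan : Submodule.span F (Set.range v) = residual x) (hw : ∀ i, w i - x (w i) = v i)
    (hsq : ¬ IsSquare (gram Q w v).det) : spinorNorm Q x = 1 := by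
  have hodd : ¬ Even (Nat.card F) := by
    let := Fintype.ofFinite F
    rw [Nat.card_eq_fintype_card, Nat.not_even_iff, FiniteField.odd_card_of_char_ne_two hF]
  rw [spinorNorm, if_neg hodd, if_neg]
  rwa [isSquare_det_wallForm_iff hx hli hspan hw]

/-- An involution in dimension at least three commutes with an element of `SO` of spinor norm `1`. -/
theorem exists_commute_of_involution [Finite F] [FiniteDimensional F V] (hF : ringChar F ≠ 2)
    (hdim : 3 ≤ finrank F V) {Q : QuadraticForm F V} (hQ : NonSingular Q) {x : V ≃ₗ[F] V}
    (hx : x ∈ O Q) (hxx : ∀ v, x (x v) = v) :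
    ∃ c ∈ SO Q, spinorNorm Q c = 1 ∧ Commute x c := by
  classical
  let := Fintype.ofFinite F
  have h2 : (2 : F) ≠ 0 := Ring.two_ne_zero hF
  -- The range of x − 1 lies in the kernel of x + 1, so the two eigenspaces have total dimension at
  -- least 3.
  obtain ⟨ε, hε, hε2⟩ : ∃ ε : F, ε * ε = 1 ∧
      2 ≤ finrank F (LinearMap.ker ((x : V →ₗ[F] V) - ε • LinearMap.id)) := by
    by_contra! hcon
    have h1 := hcon 1 (one_mul 1)
    have h1' := hcon (-1) (by ring)
    have h3 := LinearMap.finrank_range_add_finrank_ker ((x : V →ₗ[F] V) - (1 : F) • LinearMap.id)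
    have h4 : LinearMap.range ((x : V →ₗ[F] V) - (1 : F) • LinearMap.id) ≤
        LinearMap.ker ((x : V →ₗ[F] V) - (-1 : F) • LinearMap.id) := by
      rintro _ ⟨w, rfl⟩
      simp [hxx]
    have h5 := Submodule.finrank_mono h4
    omega
  set W := LinearMap.ker ((x : V →ₗ[F] V) - ε • LinearMap.id) with hW
  have hmem : ∀ v, v ∈ W ↔ x v = ε • v := by
    intro v
    rw [hW, LinearMap.mem_ker, LinearMap.sub_apply, sub_eq_zero]
    rfl
  obtain ⟨u, hu, v, hv, hQu, hQv, hsq⟩ := exists_not_isSquare_mul hF W hε2 (Q := Q) (by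
    intro v hv h
    apply eq_zero_of_polar hQ
    intro y
    -- Pairing v in W with this projection of y gives twice its pairing with y, so W is
    -- non-degenerate.
    have hy : y + ε • x y ∈ W := by
      rw [hmem, map_add, map_smul, hxx, smul_add, smul_smul, hε, one_smul, add_comm]
    have h3 := h _ hy
    have h4 : polar Q v (x y) = ε * polar Q v y := by
      have : v = ε • x v := by rw [(hmem v).1 hv, smul_smul, hε, one_smul]
      conv_lhs => rw [this]
      rw [polar_smul_left, polar_map hx, smul_eq_mul]
    rw [polar_add_right, polar_smul_right, h4, smul_eq_mul, ← mul_assoc, hε, one_mul,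
      ← two_mul] at h3
    exact (mul_eq_zero.1 h3).resolve_left h2)
  have hO : refl Q hQu * refl Q hQv ∈ O Q := mul_mem (refl_mem _) (refl_mem _)
  refine ⟨refl Q hQu * refl Q hQv, ⟨hO, ?_⟩, ?_, ?_⟩
  · change LinearEquiv.det _ = 1
    rw [map_mul, det_refl, det_refl]
    simp
  · refine zmod_two_eq_one fun h => ?_
    rw [spinorNorm_eq_zero_iff hF hQ hO, wallSign_mul h2 hQ (refl_mem _) (refl_mem _),
      wallSign_refl hQ, wallSign_refl hQ, ← map_mul,
      quadraticChar_one_iff_isSquare (mul_ne_zero hQu hQv)] at h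
    exact hsq h
  · exact ((refl_commute hQu hx hε ((hmem u).1 hu)).mul_left
      (refl_commute hQv hx hε ((hmem v).1 hv))).symm

/-- A pair of commuting mutually adjoint operators `a, b` on a non-degenerate subspace gives the
isometry `a b⁻¹`, whose spinor norm is the square class of `det a`. -/
theorem exists_commute_of_adjoint [Finite F] [FiniteDimensional F V] (hF : ringChar F ≠ 2)
    {Q : QuadraticForm F V} {x : V ≃ₗ[F] V} (hQ : NonSingular Q) (hx : x ∈ O Q)
    {W : Type*} [AddCommGroup W] [Module F W] [FiniteDimensional F W] (j : W →ₗ[F] V)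
    (hj : ∀ w, (∀ w', polar Q (j w) (j w') = 0) → w = 0) (y : W →ₗ[F] W)
    (hy : ∀ w, j (y w) = x (j w)) (a b : W →ₗ[F] W)
    (hadj : ∀ u v, polar Q (j (a u)) (j v) = polar Q (j u) (j (b v)))
    (hab : ∀ w, a (b w) = b (a w)) (hay : ∀ w, a (y w) = y (a w)) (hby : ∀ w, b (y w) = y (b w))
    (hinj : ∀ w, a w = b w → w = 0) (hdet : ¬ IsSquare (LinearMap.det a)) :
    ∃ c ∈ SO Q, spinorNorm Q c = 1 ∧ Commute x c := by
  have h2 : (2 : F) ≠ 0 := Ring.two_ne_zero hF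
  have hjinj : ∀ w, j w = 0 → w = 0 := fun w hw => hj w fun w' => by rw [hw, polar_zero_left]
  have hjinj' : Function.Injective j := (injective_iff_map_eq_zero j).2 hjinj
  let B : LinearMap.BilinForm F W := LinearMap.BilinForm.comp (polarBilin Q) j j
  have hB : ∀ u v, B u v = polar Q (j u) (j v) := fun _ _ => rfl
  have hBnd : B.Nondegenerate := LinearMap.BilinForm.Nondegenerate.ofSeparatingLeft hj
  have hadj' : ∀ u v, polar Q (j (b u)) (j v) = polar Q (j u) (j (a v)) := fun u v => by
    rw [polar_comm, ← hadj, polar_comm]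
  let e := finBasis F W
  have hdetB := (LinearMap.BilinForm.nondegenerate_iff_det_ne_zero e).1 hBnd
  have hdetab : LinearMap.det b = LinearMap.det a := by
    have h : B.compLeft a = B.compRight b := by
      ext u v
      exact hadj u v
    have := congrArg (fun B => (LinearMap.BilinForm.toMatrix e B).det) h
    simp only [LinearMap.BilinForm.toMatrix_compLeft, LinearMap.BilinForm.toMatrix_compRight,
      Matrix.det_mul, Matrix.det_transpose, LinearMap.det_toMatrix] at this
    rw [mul_comm] at this
    exact (mul_left_cancel₀ hdetB this).symm
  have ha0 : LinearMap.det a ≠ 0 := fun h => hdet (h ▸ IsSquare.zero)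
  let ea : W ≃ₗ[F] W := LinearMap.equivOfDetNeZero a ha0
  let eb : W ≃ₗ[F] W := LinearMap.equivOfDetNeZero b (hdetab ▸ ha0)
  have hea : ∀ w, ea w = a w := fun _ => rfl
  have heb : ∀ w, eb w = b w := fun _ => rfl
  -- This is a b⁻¹. It is an isometry since a t and b t have equal norm, and has determinant 1 since
  -- adjoints have equal determinant.
  let ec : W ≃ₗ[F] W := eb.symm.trans ea
  have hec : ∀ w, ec (b w) = a w := fun w => by
    change ea (eb.symm (eb w)) = _
    rw [eb.symm_apply_apply, hea]
  have hbsurj : ∀ w, ∃ t, b t = w := fun w => eb.surjective w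
  have hecB : ∀ w, Q (j (ec w)) = Q (j w) := by
    intro w
    obtain ⟨t, rfl⟩ := hbsurj w
    apply mul_left_cancel₀ h2
    rw [hec, ← polar_self_two, ← polar_self_two, hadj, ← hab, hadj']
  set R := LinearMap.range j
  have hcompl : IsCompl R (LinearMap.BilinForm.orthogonal (polarBilin Q) R) := by
    apply LinearMap.BilinForm.isCompl_orthogonal_of_restrict_nondegenerate (isRefl_polarBilin Q)
    apply LinearMap.BilinForm.Nondegenerate.ofSeparatingLeft
    rintro ⟨_, w, rfl⟩ h
    have : w = 0 := hj w fun w' => h ⟨j w', w', rfl⟩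
    subst this
    exact Subtype.ext (map_zero j)
  set R' := LinearMap.BilinForm.orthogonal (polarBilin Q) R
  let E : (W × R') ≃ₗ[F] V := ((LinearEquiv.ofInjective j hjinj').prodCongr
    (LinearEquiv.refl F R')).trans (Submodule.prodEquivOfIsCompl R R' hcompl)
  have hE : ∀ w t, E (w, t) = j w + t := fun _ _ => rfl
  have hort : ∀ w (t : R'), polar Q (j w) t = 0 := fun w t =>
    (LinearMap.BilinForm.mem_orthogonal_iff.1 t.2) _ ⟨w, rfl⟩
  let c : V ≃ₗ[F] V := (E.symm.trans (ec.prodCongr (LinearEquiv.refl F R'))).trans E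
  have hc : ∀ w (t : R'), c (j w + t) = j (ec w) + t := by
    intro w t
    rw [← hE, ← hE]
    change E ((ec.prodCongr (LinearEquiv.refl F R')) (E.symm (E (w, t)))) = _
    rw [E.symm_apply_apply]
    rfl
  have hdecomp : ∀ v, ∃ w, ∃ t : R', j w + t = v := fun v => by
    obtain ⟨⟨w, t⟩, h⟩ := E.surjective v
    exact ⟨w, t, h⟩
  have hcj : ∀ w, c (j w) = j (ec w) := fun w => by simpa using hc w 0
  have hcO : c ∈ O Q := by
    intro v
    obtain ⟨w, t, rfl⟩ := hdecomp v
    rw [hc, map_add_polar, map_add_polar, hort, hort, hecB]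
  have hcdet : LinearEquiv.det c = 1 := by
    ext
    rw [LinearEquiv.coe_det, Units.val_one]
    have h1 : (c : V →ₗ[F] V) = (E : (W × R') →ₗ[F] V) ∘ₗ
        (LinearMap.prodMap (ec : W →ₗ[F] W) LinearMap.id) ∘ₗ (E.symm : V →ₗ[F] W × R') := rfl
    rw [h1, LinearMap.det_conj, LinearMap.det_prodMap, LinearMap.det_id, mul_one]
    have h3 : (ec : W →ₗ[F] W) ∘ₗ b = a := by
      ext w
      exact hec w
    have h4 := congrArg LinearMap.det h3
    rw [LinearMap.det_comp, hdetab] at h4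
    exact mul_right_cancel₀ ha0 (h4.trans (one_mul _).symm)
  have hyinj : Function.Injective y := by
    intro u v h
    apply hjinj'
    apply x.injective
    rw [← hy, ← hy, h]
  have hysurj : Function.Surjective y := LinearMap.injective_iff_surjective.1 hyinj
  have hxc : Commute x c := by
    ext v
    obtain ⟨w, t, rfl⟩ := hdecomp v
    have ht : x t ∈ R' := by
      rw [LinearMap.BilinForm.mem_orthogonal_iff]
      rintro _ ⟨w, rfl⟩
      obtain ⟨w, rfl⟩ := hysurj w
      change polar Q _ _ = 0
      rw [hy, polar_map hx, hort]
    have hec' : y (ec w) = ec (y w) := by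
      obtain ⟨s, rfl⟩ := hbsurj w
      rw [hec, ← hby, hec, hay]
    rw [LinearEquiv.mul_apply, LinearEquiv.mul_apply, hc, map_add, map_add, ← hy, ← hy,
      hc (y w) ⟨x t, ht⟩, hec']
  have hsinj : Function.Injective (b - a) := by
    rw [injective_iff_map_eq_zero]
    intro w hw
    exact hinj w (sub_eq_zero.1 hw).symm
  let s : W ≃ₗ[F] W := LinearEquiv.ofInjectiveEndo (b - a) hsinj
  have hs : ∀ w, s w = b w - a w := fun _ => rfl
  refine ⟨c, ⟨hcO, hcdet⟩, ?_, hxc⟩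
  -- Since s = b − a is skew-adjoint, pairing through its inverse is alternating.
  let ω : LinearMap.BilinForm F W := B.compLeft (s.symm : W →ₗ[F] W)
  have hω : ∀ u v, ω u v = polar Q (j (s.symm u)) (j v) := fun _ _ => rfl
  have halt : ω.IsAlt := by
    intro u
    obtain ⟨t, rfl⟩ := s.surjective u
    rw [hω, s.symm_apply_apply, hs, map_sub, polar_sub_right, ← hadj, polar_comm, sub_self]
  -- From c (b t) = a t, the vector b s⁻¹ u is a preimage of u under 1 − c.
  have hwi : ∀ u, j (b (s.symm u)) - c (j (b (s.symm u))) = j u := by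
    intro u
    obtain ⟨t, rfl⟩ := s.surjective u
    rw [s.symm_apply_apply, hcj, hec, ← map_sub, ← hs]
  have hli : LinearIndependent F (fun i => j (e i)) :=
    e.linearIndependent.map' j (LinearMap.ker_eq_bot.2 hjinj')
  have hspan : Submodule.span F (Set.range fun i => j (e i)) = residual c := by
    apply le_antisymm
    · rw [Submodule.span_le]
      rintro _ ⟨i, rfl⟩
      exact ⟨_, hwi (e i)⟩
    · have hsp : Submodule.span F (Set.range fun i => j (e i)) = R := by
        have : (Set.range fun i => j (e i)) = j '' Set.range e := by
          rw [← Set.range_comp]; rfl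
        rw [this, ← Submodule.map_span, Basis.span_eq, Submodule.map_top]
      rw [hsp]
      rintro _ ⟨v, rfl⟩
      obtain ⟨w, t, rfl⟩ := hdecomp v
      refine ⟨w - ec w, ?_⟩
      rw [oneSub_apply, hc, map_sub]
      abel
  -- Moving b across as its adjoint a factors the Wall form as ω followed by a; det ω is a square,
  -- which leaves det a.
  have hgram : gram Q (fun i => j (b (s.symm (e i)))) (fun i => j (e i)) =
      LinearMap.BilinForm.toMatrix e ω * LinearMap.toMatrix e e a := by
    rw [← LinearMap.BilinForm.toMatrix_compRight]
    ext i k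
    rw [LinearMap.BilinForm.toMatrix_apply]
    exact hadj' _ _
  refine spinorNorm_eq_one_of_gram hF hcO hli hspan (fun i => hwi (e i)) ?_
  have hne := det_gram_ne_zero hQ hcO hli hspan (fun i => hwi (e i))
  rw [hgram, Matrix.det_mul, LinearMap.det_toMatrix] at hne ⊢
  obtain ⟨q, hq⟩ := isSquare_det_of_isAlt halt e
  rintro ⟨r, hr⟩
  rw [hq] at hne hr
  have hq0 : q ≠ 0 := by
    rintro rfl
    simp at hne
  exact hdet ⟨r / q, by field_simp; linear_combination hr⟩

end AdjointPairs

/-! ### Irreducible operators and non-square determinants -/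

section IrreducibleOperators

open QuadraticMap Module Polynomial
variable {F V : Type*} [Field F] [AddCommGroup V] [Module F V]

/-- `y` acts irreducibly. -/
def Irred {U : Type*} [AddCommGroup U] [Module F U] (y : U →ₗ[F] U) : Prop :=
  ∀ W : Submodule F U, (∀ u ∈ W, y u ∈ W) → W = ⊥ ∨ W = ⊤

section Irred

variable {U : Type*} [AddCommGroup U] [Module F U] {y : U →ₗ[F] U}

/-- Schur's lemma: the kernel of a is invariant under y. -/
theorem Irred.eq_zero_or_injective (hy : Irred y) {a : U →ₗ[F] U} (ha : ∀ u, a (y u) = y (a u)) :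
    a = 0 ∨ Function.Injective a := by
  rcases hy (LinearMap.ker a) (fun u hu => by
    rw [LinearMap.mem_ker] at hu ⊢; rw [ha, hu, map_zero]) with h | h
  · exact Or.inr (LinearMap.ker_eq_bot.1 h)
  · exact Or.inl (LinearMap.ker_eq_top.1 h)

theorem aeval_comm {a b : U →ₗ[F] U} (h : ∀ u, a (b u) = b (a u)) (p : F[X]) (u : U) :
    aeval (R := F) (A := Module.End F U) a p (b u) =
      b (aeval (R := F) (A := Module.End F U) a p u) := by
  induction p using Polynomial.induction_on' with
  | add p q hp hq => rw [map_add, LinearMap.add_apply, LinearMap.add_apply, hp, hq, map_add]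
  | monomial n c =>
    rw [aeval_monomial, Module.algebraMap_end_eq_smul_id]
    simp only [Module.End.mul_apply, LinearMap.smul_apply, LinearMap.id_apply, map_smul]
    congr 1
    induction n generalizing u with
    | zero => rfl
    | succ n ih => rw [pow_succ, Module.End.mul_apply, Module.End.mul_apply, h, ih]

/-- Polynomials in an irreducible operator over a finite field of odd characteristic take
non-square determinants. -/
theorem Irred.exists_det_not_isSquare [Finite F] [FiniteDimensional F U] [Nontrivial U]
    (hF : ringChar F ≠ 2) (hy : Irred y) :
    ∃ p : F[X], ¬ IsSquare (LinearMap.det (aeval (R := F) (A := Module.End F U) y p)) := by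
  have : Finite U := Module.finite_of_finite F
  -- By Schur's lemma this finite commutative algebra is a domain, hence a field, and its norm to F
  -- is surjective.
  let A := Algebra.adjoin F {(y : Module.End F U)}
  have hmem : ∀ e : A, ∃ p : F[X], aeval (R := F) (A := Module.End F U) y p = e := by
    intro e
    have : (e : Module.End F U) ∈ Algebra.adjoin F {(y : Module.End F U)} := e.2
    rw [Algebra.adjoin_singleton_eq_range_aeval] at this
    exact this
  have hinj : ∀ e : A, e ≠ 0 → Function.Injective (e : Module.End F U) := by
    intro e he
    obtain ⟨p, hp⟩ := hmem e
    refine (hy.eq_zero_or_injective (a := (e : Module.End F U)) ?_).resolve_left ?_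
    · intro u
      rw [← hp]
      exact aeval_comm (fun _ => rfl) p u
    · intro h
      exact he (Subtype.ext h)
  have hcomm : ∀ a b : A, a * b = b * a := by
    intro a b
    obtain ⟨p, hp⟩ := hmem a
    obtain ⟨q, hq⟩ := hmem b
    apply Subtype.ext
    change (a : Module.End F U) * b = b * a
    rw [← hp, ← hq, ← map_mul, mul_comm, map_mul]
  let : CommRing A := { (inferInstance : Ring A) with mul_comm := hcomm }
  have : Nontrivial A := ⟨⟨0, 1, fun h => by
    obtain ⟨u, hu⟩ := exists_ne (0 : U)
    exact hu (LinearMap.congr_fun (congrArg Subtype.val h) u).symm⟩⟩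
  have : NoZeroDivisors A := ⟨fun {a b} h => by
    by_contra! hcon
    apply hcon.2
    apply Subtype.ext
    ext u
    apply hinj a hcon.1
    have := LinearMap.congr_fun (congrArg Subtype.val h) u
    exact this.trans (map_zero _).symm⟩
  have : IsDomain A := NoZeroDivisors.to_isDomain A
  have : Finite (Module.End F U) := DFunLike.finite _
  have : Finite A := Subtype.finite
  let : Field A := (Finite.isField_of_domain A).toField
  obtain ⟨ν, hν⟩ : ∃ ν : F, ¬ IsSquare ν := FiniteField.exists_nonsquare hF
  obtain ⟨e, he⟩ := FiniteField.norm_surjective F A ν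
  obtain ⟨u₀, hu₀⟩ := exists_ne (0 : U)
  -- Evaluation at a nonzero vector identifies A with U, turning multiplication by e into the action
  -- of e; so the determinant of e on U is its norm.
  let φ₀ : A →ₗ[F] U := (LinearMap.applyₗ u₀) ∘ₗ A.val.toLinearMap
  have hφ₀ : ∀ e : A, φ₀ e = (e : Module.End F U) u₀ := fun _ => rfl
  have hφinj : Function.Injective φ₀ := by
    rw [injective_iff_map_eq_zero]
    intro e he
    by_contra hne
    exact hu₀ (hinj e hne (he.trans (map_zero _).symm))
  have hφsurj : Function.Surjective φ₀ := by
    rw [← LinearMap.range_eq_top]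
    refine (hy (LinearMap.range φ₀) ?_).resolve_left ?_
    · rintro _ ⟨e, rfl⟩
      exact ⟨⟨y, Algebra.subset_adjoin rfl⟩ * e, rfl⟩
    · intro h
      have : φ₀ 1 ∈ LinearMap.range φ₀ := ⟨1, rfl⟩
      rw [h, Submodule.mem_bot] at this
      exact hu₀ this
  let φ : A ≃ₗ[F] U := LinearEquiv.ofBijective φ₀ ⟨hφinj, hφsurj⟩
  obtain ⟨p, hp⟩ := hmem e
  refine ⟨p, ?_⟩
  have hconj : (φ : A →ₗ[F] U) ∘ₗ (LinearMap.mul F A e) ∘ₗ (φ.symm : U →ₗ[F] A) =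
      (e : Module.End F U) := by
    ext u
    obtain ⟨t, rfl⟩ := φ.surjective u
    simp only [LinearMap.comp_apply, LinearEquiv.coe_coe, φ.symm_apply_apply]
    rfl
  rw [hp, ← hconj, LinearMap.det_conj]
  rw [← he, Algebra.norm_apply] at hν
  exact hν

end Irred

/-- Adjointness passes to polynomials. Two embeddings are allowed so that the result also covers
dual isotropic subspaces. -/
theorem polar_aeval {Q : QuadraticForm F V} {U W : Type*} [AddCommGroup U] [Module F U]
    [AddCommGroup W] [Module F W] (i : U →ₗ[F] V) (j : W →ₗ[F] V) {a : U →ₗ[F] U}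
    {b : W →ₗ[F] W} (h : ∀ u w, polar Q (i (a u)) (j w) = polar Q (i u) (j (b w))) (p : F[X])
    (u : U) (w : W) :
    polar Q (i (aeval (R := F) (A := Module.End F U) a p u)) (j w) =
      polar Q (i u) (j (aeval (R := F) (A := Module.End F W) b p w)) := by
  induction p using Polynomial.induction_on' with
  | add p q hp hq =>
    rw [map_add, map_add, LinearMap.add_apply, LinearMap.add_apply, map_add, map_add,
      polar_add_left, polar_add_right, hp, hq]
  | monomial n c =>
    rw [aeval_monomial, aeval_monomial, Module.algebraMap_end_eq_smul_id,
      Module.algebraMap_end_eq_smul_id]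
    simp only [Module.End.mul_apply, LinearMap.smul_apply, LinearMap.id_apply, map_smul,
      polar_smul_left, polar_smul_right]
    congr 1
    induction n generalizing w with
    | zero => rfl
    | succ n ih => rw [pow_succ', pow_succ, Module.End.mul_apply, Module.End.mul_apply, h, ih]

/-- The case of a non-degenerate irreducible subspace. -/
theorem exists_commute_of_nondegenerate [Finite F] [FiniteDimensional F V] (hF : ringChar F ≠ 2)
    {Q : QuadraticForm F V} {x : V ≃ₗ[F] V} (hQ : NonSingular Q) (hx : x ∈ O Q)
    {W : Type*} [AddCommGroup W] [Module F W] [FiniteDimensional F W] [Nontrivial W]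
    (j : W →ₗ[F] V) (hj : ∀ w, (∀ w', polar Q (j w) (j w') = 0) → w = 0) (y y' : W →ₗ[F] W)
    (hy : ∀ w, j (y w) = x (j w)) (hyy : ∀ w, y (y' w) = w) (hyy' : ∀ w, y' (y w) = w)
    (hirr : Irred y) (hne : ∃ w, y (y w) ≠ w) :
    ∃ c ∈ SO Q, spinorNorm Q c = 1 ∧ Commute x c := by
  obtain ⟨p, hp⟩ := hirr.exists_det_not_isSquare hF
  set a : W →ₗ[F] W := aeval (R := F) (A := Module.End F W) y p with ha
  set b : W →ₗ[F] W := aeval (R := F) (A := Module.End F W) y' p with hb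
  have hadj0 : ∀ u v, polar Q (j (y u)) (j v) = polar Q (j u) (j (y' v)) := by
    intro u v
    conv_lhs => rw [← hyy v]
    rw [hy, hy, polar_map hx]
  have hadj : ∀ u v, polar Q (j (a u)) (j v) = polar Q (j u) (j (b v)) :=
    polar_aeval j j hadj0 p
  have hay : ∀ w, a (y w) = y (a w) := aeval_comm (fun _ => rfl) p
  have hby : ∀ w, b (y w) = y (b w) := aeval_comm (fun u => by rw [hyy, hyy']) p
  have hab : ∀ w, a (b w) = b (a w) := aeval_comm (fun u => (hby u).symm) p
  refine exists_commute_of_adjoint hF hQ hx j hj y hy a b hadj hab hay hby ?_ hp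
  rcases hirr.eq_zero_or_injective (a := a - b) (fun u => by
    rw [LinearMap.sub_apply, LinearMap.sub_apply, hay, hby, map_sub]) with h | h
  swap
  · intro w hw
    apply h
    rw [LinearMap.sub_apply, hw, sub_self, map_zero]
  exfalso
  -- If a were self-adjoint, the form given by the skew-adjoint y − y⁻¹ would be alternating and
  -- non-degenerate, and would stay alternating after composition with a. Both determinants are
  -- squares, hence so is det a.
  have hab' : a = b := sub_eq_zero.1 h
  have hs : Function.Injective (y - y') := by
    refine (hirr.eq_zero_or_injective (a := y - y') (fun u => by
      rw [LinearMap.sub_apply, LinearMap.sub_apply, map_sub, hyy, hyy'])).resolve_left fun h0 => ?_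
    obtain ⟨w, hw⟩ := hne
    apply hw
    exact (LinearMap.congr_fun (sub_eq_zero.1 h0) (y w)).trans (hyy' w)
  let B : LinearMap.BilinForm F W := LinearMap.BilinForm.comp (polarBilin Q) j j
  have hBnd : B.Nondegenerate := LinearMap.BilinForm.Nondegenerate.ofSeparatingLeft hj
  let ω := B.compLeft (y - y')
  have hω : ∀ u v, ω u v = polar Q (j (y u)) (j v) - polar Q (j (y' u)) (j v) := by
    intro u v
    rw [← polar_sub_left, ← map_sub]
    rfl
  have hadj0' : ∀ u v, polar Q (j (y' u)) (j v) = polar Q (j u) (j (y v)) := fun u v => by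
    rw [polar_comm, ← hadj0, polar_comm]
  have halt : ω.IsAlt := fun u => by
    rw [hω, hadj0', polar_comm, sub_self]
  have halt' : LinearMap.BilinForm.IsAlt (ω.compRight a) := fun u => by
    have h1 : ω.compRight a u u = ω u (a u) := rfl
    have h2 : polar Q (j (y u)) (j (a u)) = polar Q (j (y' u)) (j (a u)) := by
      rw [polar_comm, hadj, ← hab', hay, ← hadj0']
    rw [h1, hω, h2, sub_self]
  let e := finBasis F W
  obtain ⟨q, hq⟩ := isSquare_det_of_isAlt halt e
  obtain ⟨r, hr⟩ := isSquare_det_of_isAlt halt' e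
  rw [LinearMap.BilinForm.toMatrix_compRight, Matrix.det_mul, LinearMap.det_toMatrix, hq] at hr
  have hq0 : q ≠ 0 := by
    rintro rfl
    rw [LinearMap.BilinForm.toMatrix_compLeft, Matrix.det_mul, Matrix.det_transpose,
      LinearMap.det_toMatrix, mul_zero] at hq
    rcases mul_eq_zero.1 hq with h5 | h5
    · have := LinearMap.bot_lt_ker_of_det_eq_zero h5
      rw [LinearMap.ker_eq_bot.2 hs] at this
      exact lt_irrefl _ this
    · exact (LinearMap.BilinForm.nondegenerate_iff_det_ne_zero e).1 hBnd h5
  exact hp ⟨r / q, by field_simp; linear_combination hr⟩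

/-- The case of a hyperbolic pair of invariant totally isotropic subspaces. -/
theorem exists_commute_of_isotropic [Finite F] [FiniteDimensional F V] (hF : ringChar F ≠ 2)
    {Q : QuadraticForm F V} {x : V ≃ₗ[F] V} (hQ : NonSingular Q) (hx : x ∈ O Q)
    {U W : Type*} [AddCommGroup U] [Module F U] [FiniteDimensional F U] [Nontrivial U]
    [AddCommGroup W] [Module F W] [FiniteDimensional F W]
    (i : U →ₗ[F] V) (j : W →ₗ[F] V) (hi : ∀ u u', polar Q (i u) (i u') = 0)
    (hj : ∀ w w', polar Q (j w) (j w') = 0) (hij : ∀ u, (∀ w, polar Q (i u) (j w) = 0) → u = 0)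
    (hji : ∀ w, (∀ u, polar Q (i u) (j w) = 0) → w = 0) (y : U →ₗ[F] U) (z z' : W →ₗ[F] W)
    (hy : ∀ u, i (y u) = x (i u)) (hz : ∀ w, j (z w) = x (j w)) (hzz : ∀ w, z (z' w) = w)
    (hzz' : ∀ w, z' (z w) = w) (hirr : Irred y) :
    ∃ c ∈ SO Q, spinorNorm Q c = 1 ∧ Commute x c := by
  obtain ⟨p, hp⟩ := hirr.exists_det_not_isSquare hF
  set a : U →ₗ[F] U := aeval (R := F) (A := Module.End F U) y p with ha
  set b : W →ₗ[F] W := aeval (R := F) (A := Module.End F W) z' p with hb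
  have hadj : ∀ u w, polar Q (i (a u)) (j w) = polar Q (i u) (j (b w)) :=
    polar_aeval i j (fun u w => by
      conv_lhs => rw [← hzz w]
      rw [hy, hz, polar_map hx]) p
  have hay : ∀ w, a (y w) = y (a w) := aeval_comm (fun _ => rfl) p
  have hbz : ∀ w, b (z w) = z (b w) := aeval_comm (fun u => by rw [hzz, hzz']) p
  -- By Schur's lemma, since a = 1 would have square determinant.
  have hinj : Function.Injective (a - LinearMap.id : U →ₗ[F] U) := by
    refine (hirr.eq_zero_or_injective (a := (a - LinearMap.id : U →ₗ[F] U)) (fun u => by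
      simp [hay])).resolve_left fun h0 => hp ?_
    rw [sub_eq_zero.1 h0, LinearMap.det_id]
    exact IsSquare.one
  have hsurj : Function.Surjective (a - LinearMap.id : U →ₗ[F] U) := LinearMap.injective_iff_surjective.1 hinj
  have hadd : ∀ u w u' w', polar Q (i u + j w) (i u' + j w') =
      polar Q (i u) (j w') + polar Q (i u') (j w) := by
    intro u w u' w'
    rw [polar_add_left, polar_add_right, polar_add_right, hi, hj, polar_comm Q (j w)]
    ring
  -- On U × W the adjoint of a ⊕ 1 is 1 ⊕ b, and the determinant is still det a.
  refine exists_commute_of_adjoint hF hQ hx (LinearMap.coprod i j) ?_ (LinearMap.prodMap y z) ?_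
    (LinearMap.prodMap a LinearMap.id) (LinearMap.prodMap LinearMap.id b) ?_ ?_ ?_ ?_ ?_ ?_
  · rintro ⟨u, w⟩ h
    have h1 : u = 0 := hij u fun w' => by simpa [hj] using h (0, w')
    have h2 : w = 0 := hji w fun u' => by
      have := h (u', 0)
      rwa [LinearMap.coprod_apply, LinearMap.coprod_apply, hadd, map_zero, polar_zero_right,
        zero_add] at this
    rw [h1, h2]; rfl
  · rintro ⟨u, w⟩
    simp [hy, hz]
  · rintro ⟨u, w⟩ ⟨u', w'⟩
    simp only [LinearMap.prodMap_apply, LinearMap.coprod_apply, LinearMap.id_apply, hadd, hadj]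
  · rintro ⟨u, w⟩
    rfl
  · rintro ⟨u, w⟩
    simp [hay]
  · rintro ⟨u, w⟩
    simp [hbz]
  · rintro ⟨u, w⟩ h
    simp only [LinearMap.prodMap_apply, LinearMap.id_apply, Prod.mk.injEq] at h
    have h1 : u = 0 := by
      apply hinj
      rw [LinearMap.sub_apply, LinearMap.id_apply, h.1, sub_self, map_zero]
    -- A vector w with b w = w is orthogonal to (a − 1)U = U.
    have h2 : w = 0 := hji w fun u' => by
      obtain ⟨t, rfl⟩ := hsurj u'
      rw [LinearMap.sub_apply, LinearMap.id_apply, map_sub, polar_sub_left, hadj, ← h.2, sub_self]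
    rw [h1, h2]; rfl
  · rwa [LinearMap.det_prodMap, LinearMap.det_id, mul_one]

end IrreducibleOperators

/-! ### Reduction to irreducible invariant subspaces -/

section InvariantSubspaces

open QuadraticMap Module Polynomial
variable {F V : Type*} [Field F] [AddCommGroup V] [Module F V]

section Invariant

variable {x : V ≃ₗ[F] V} {U : Submodule F V}

theorem symm_mem_of_invariant [FiniteDimensional F V] (hU : ∀ u ∈ U, x u ∈ U) :
    ∀ u ∈ U, x.symm u ∈ U := by
  intro u hu
  let y : U →ₗ[F] U := (x : V →ₗ[F] V).restrict hU
  have hinj : Function.Injective y := fun a b h =>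
    Subtype.ext (x.injective (congrArg Subtype.val h))
  obtain ⟨w, hw⟩ := LinearMap.injective_iff_surjective.1 hinj ⟨u, hu⟩
  have : x w = u := congrArg Subtype.val hw
  rw [← this, x.symm_apply_apply]
  exact w.2

theorem orthogonal_invariant [FiniteDimensional F V] {Q : QuadraticForm F V} (hx : x ∈ O Q)
    (hU : ∀ u ∈ U, x u ∈ U) : ∀ w ∈ LinearMap.BilinForm.orthogonal (polarBilin Q) U,
      x w ∈ LinearMap.BilinForm.orthogonal (polarBilin Q) U := by
  intro w hw
  rw [LinearMap.BilinForm.mem_orthogonal_iff] at hw ⊢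
  intro u hu
  have := hw _ (symm_mem_of_invariant hU u hu)
  change polar Q u (x w) = 0
  rw [polar_comm, polar_symm_map hx, polar_comm]
  exact this

theorem irred_restrict (hU : ∀ u ∈ U, x u ∈ U)
    (hirr : ∀ W ≤ U, (∀ w ∈ W, x w ∈ W) → W = ⊥ ∨ W = U) :
    Irred ((x : V →ₗ[F] V).restrict hU) := by
  intro W hW
  rcases hirr (W.map U.subtype) (Submodule.map_subtype_le U W) (by
    rintro _ ⟨w, hw, rfl⟩
    exact ⟨_, hW w hw, rfl⟩) with h | h
  · left
    rw [eq_bot_iff]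
    intro w hw
    have : (w : V) ∈ W.map U.subtype := ⟨w, hw, rfl⟩
    rw [h, Submodule.mem_bot] at this
    exact Subtype.ext this
  · right
    rw [eq_top_iff]
    rintro u -
    have : (u : V) ∈ W.map U.subtype := by rw [h]; exact u.2
    obtain ⟨w, hw, hwu⟩ := this
    rwa [← Subtype.ext (show (w : V) = u from hwu)]

/-- A space that is paired without left kernel with another one has at most its dimension. -/
theorem finrank_le_of_pairing [FiniteDimensional F V] {Q : QuadraticForm F V} {U W : Submodule F V}
    (h : ∀ u ∈ U, (∀ w ∈ W, polar Q u w = 0) → u = 0) : finrank F U ≤ finrank F W := by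
  let φ : U →ₗ[F] Dual F W := (((polarBilin Q).comp U.subtype).compl₂ W.subtype)
  have hφ : Function.Injective φ := by
    rw [injective_iff_map_eq_zero]
    intro u hu
    exact Subtype.ext (h u u.2 fun w hw => LinearMap.congr_fun hu ⟨w, hw⟩)
  have := LinearMap.finrank_le_finrank_of_injective hφ
  rwa [Subspace.dual_finrank_eq] at this

/-- The case of a non-degenerate irreducible invariant subspace. -/
theorem exists_commute_of_irreducible [Finite F] [FiniteDimensional F V] (hF : ringChar F ≠ 2)
    {Q : QuadraticForm F V} (hQ : NonSingular Q) (hx : x ∈ O Q) (hU : ∀ u ∈ U, x u ∈ U)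
    (hirr : ∀ W ≤ U, (∀ w ∈ W, x w ∈ W) → W = ⊥ ∨ W = U) (hne : ∃ u ∈ U, x (x u) ≠ u)
    (hnd : U ⊓ LinearMap.BilinForm.orthogonal (polarBilin Q) U = ⊥) :
    ∃ c ∈ SO Q, spinorNorm Q c = 1 ∧ Commute x c := by
  obtain ⟨u, hu, hxu⟩ := hne
  have : Nontrivial U := ⟨⟨⟨u, hu⟩, 0, fun h => hxu (by
    rw [show u = 0 from congrArg Subtype.val h, map_zero, map_zero])⟩⟩
  refine exists_commute_of_nondegenerate hF hQ hx U.subtype ?_ ((x : V →ₗ[F] V).restrict hU)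
    ((x.symm : V →ₗ[F] V).restrict (symm_mem_of_invariant hU)) (fun _ => rfl)
    (fun w => Subtype.ext (x.apply_symm_apply w)) (fun w => Subtype.ext (x.symm_apply_apply w))
    (irred_restrict hU hirr) ⟨⟨u, hu⟩, fun h => hxu (congrArg Subtype.val h)⟩
  intro w hw
  have : (w : V) ∈ U ⊓ LinearMap.BilinForm.orthogonal (polarBilin Q) U := by
    refine ⟨w.2, LinearMap.BilinForm.mem_orthogonal_iff.2 fun u hu => ?_⟩
    change polar Q u w = 0
    rw [polar_comm]
    exact hw ⟨u, hu⟩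
  rw [hnd, Submodule.mem_bot] at this
  exact Subtype.ext this

end Invariant

/-- A semisimple element that is not an involution has an irreducible invariant subspace on which
`x ^ 2` is not the identity. -/
theorem exists_irreducible [FiniteDimensional F V] {x : V ≃ₗ[F] V}
    (hss : Module.End.IsSemisimple (x : Module.End F V)) (hxx : ¬ ∀ v, x (x v) = v) :
    ∃ U : Submodule F V, (∀ u ∈ U, x u ∈ U) ∧
      (∀ W ≤ U, (∀ w ∈ W, x w ∈ W) → W = ⊥ ∨ W = U) ∧ ∃ u ∈ U, x (x u) ≠ u := by
  let f : Module.End F V := aeval (x : Module.End F V) (X ^ 2 - 1 : F[X])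
  have hf : ∀ v, f v = x (x v) - v := by
    intro v
    simp only [f, map_sub, map_pow, aeval_X, map_one]
    rfl
  have hfss : f.IsSemisimple := hss.aeval _
  -- A minimal member is irreducible. Lying in the range of f = x² − 1, it meets the kernel of f
  -- trivially by semisimplicity.
  let S : Set (Submodule F V) := {U | U ≠ ⊥ ∧ (∀ u ∈ U, x u ∈ U) ∧ U ≤ LinearMap.range f}
  have hS : S.Nonempty := by
    refine ⟨LinearMap.range f, ?_, ?_, le_rfl⟩
    · intro h
      apply hxx
      intro v
      have : f v ∈ LinearMap.range f := ⟨v, rfl⟩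
      rw [h, Submodule.mem_bot, hf] at this
      exact sub_eq_zero.1 this
    · rintro _ ⟨v, rfl⟩
      exact ⟨x v, by rw [hf, hf, map_sub]⟩
  obtain ⟨U, ⟨hU0, hUinv, hUle⟩, hmin⟩ := wellFounded_lt.has_min S hS
  refine ⟨U, hUinv, ?_, ?_⟩
  · intro W hWU hW
    by_contra! hcon
    exact hmin W ⟨hcon.1, hW, hWU.trans hUle⟩ (lt_of_le_of_ne hWU hcon.2)
  · obtain ⟨u, hu, hu0⟩ := (Submodule.ne_bot_iff _).1 hU0
    refine ⟨u, hu, fun h => hu0 ?_⟩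
    obtain ⟨v, rfl⟩ := hUle hu
    exact ker_disjoint_range_of_isSemisimple hfss (by rw [hf, h, sub_self])

/-- In odd characteristic, a semisimple isometry commutes with an element of `SO` outside
`Omega`. -/
theorem exists_commute_of_odd [Finite F] [FiniteDimensional F V] (hF : ringChar F ≠ 2)
    (hdim : 3 ≤ finrank F V) {Q : QuadraticForm F V} (hQ : NonSingular Q) {x : V ≃ₗ[F] V}
    (hx : x ∈ O Q) (hss : Module.End.IsSemisimple (x : Module.End F V)) :
    ∃ c ∈ SO Q, spinorNorm Q c = 1 ∧ Commute x c := by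
  by_cases hxx : ∀ v, x (x v) = v
  · exact exists_commute_of_involution hF hdim hQ hx hxx
  obtain ⟨U, hU, hirr, hne⟩ := exists_irreducible hss hxx
  set P := LinearMap.BilinForm.orthogonal (polarBilin Q) U with hP
  have hPinv := orthogonal_invariant hx hU
  rcases hirr (U ⊓ P) inf_le_left (fun w hw => ⟨hU w hw.1, hPinv w hw.2⟩) with h | h
  · exact exists_commute_of_irreducible hF hQ hx hU hirr hne h
  have hUU : ∀ u ∈ U, ∀ u' ∈ U, polar Q u u' = 0 := by
    intro u hu u' hu'
    rw [← h] at hu'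
    exact LinearMap.BilinForm.mem_orthogonal_iff.1 hu'.2 u hu
  -- U is now totally isotropic; an invariant complement W of its orthogonal space is in perfect
  -- duality with U.
  obtain ⟨W, hW, hcompl⟩ := Module.End.isSemisimple_iff.1 hss P hPinv
  replace hW : ∀ w ∈ W, x w ∈ W := hW
  have hUW : ∀ u ∈ U, (∀ w ∈ W, polar Q u w = 0) → u = 0 := by
    intro u hu h0
    apply eq_zero_of_polar hQ
    intro v
    obtain ⟨k, hk, w, hw, rfl⟩ := Submodule.mem_sup.1
      (hcompl.sup_eq_top ▸ Submodule.mem_top : v ∈ P ⊔ W)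
    have hk' : polar Q u k = 0 := LinearMap.BilinForm.mem_orthogonal_iff.1 hk u hu
    rw [polar_add_right, h0 w hw, hk', add_zero]
  have hWU : ∀ w ∈ W, (∀ u ∈ U, polar Q u w = 0) → w = 0 := fun w hw h0 =>
    Submodule.disjoint_def.1 hcompl.disjoint w (LinearMap.BilinForm.mem_orthogonal_iff.2 h0) hw
  have hWirr : ∀ Z ≤ W, (∀ w ∈ Z, x w ∈ Z) → Z = ⊥ ∨ Z = W := by
    intro Z hZW hZ
    -- Irreducibility passes to W by duality: the part of U orthogonal to Z is 0, forcing Z = W by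
    -- dimension, or U, forcing Z = 0.
    rcases hirr (U ⊓ LinearMap.BilinForm.orthogonal (polarBilin Q) Z) inf_le_left
      (fun w hw => ⟨hU w hw.1, orthogonal_invariant hx hZ w hw.2⟩) with h1 | h1
    · right
      apply Submodule.eq_of_le_of_finrank_le hZW
      have h2 : finrank F W ≤ finrank F U := finrank_le_of_pairing (Q := Q) fun w hw h0 =>
        hWU w hw fun u hu => by rw [polar_comm, h0 u hu]
      have h3 : finrank F U ≤ finrank F Z := finrank_le_of_pairing (Q := Q) fun u hu h0 => by
        have : u ∈ U ⊓ LinearMap.BilinForm.orthogonal (polarBilin Q) Z := by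
          refine ⟨hu, LinearMap.BilinForm.mem_orthogonal_iff.2 fun w hw => ?_⟩
          change polar Q w u = 0
          rw [polar_comm, h0 w hw]
        rwa [h1, Submodule.mem_bot] at this
      exact h2.trans h3
    · left
      rw [eq_bot_iff]
      intro w hw
      refine hWU w (hZW hw) fun u hu => ?_
      rw [← h1] at hu
      rw [polar_comm]
      exact LinearMap.BilinForm.mem_orthogonal_iff.1 hu.2 w hw
  have hWne : ∃ w ∈ W, x (x w) ≠ w := by
    by_contra! hcon
    obtain ⟨u, hu, hxu⟩ := hne
    apply hxu
    rw [← sub_eq_zero]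
    refine hUW _ (U.sub_mem (hU _ (hU _ hu)) hu) fun w hw => ?_
    rw [polar_sub_left]
    conv_lhs => rw [← hcon w hw]
    rw [polar_map hx, polar_map hx, hcon w hw, sub_self]
  -- Either W is non-degenerate and replaces U, or U and W form a hyperbolic pair.
  rcases hWirr (W ⊓ LinearMap.BilinForm.orthogonal (polarBilin Q) W) inf_le_left
    (fun w hw => ⟨hW w hw.1, orthogonal_invariant hx hW w hw.2⟩) with h1 | h1
  · exact exists_commute_of_irreducible hF hQ hx hW hWirr hWne h1
  obtain ⟨u, hu, hxu⟩ := hne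
  have : Nontrivial U := ⟨⟨⟨u, hu⟩, 0, fun h => hxu (by
    rw [show u = 0 from congrArg Subtype.val h, map_zero, map_zero])⟩⟩
  refine exists_commute_of_isotropic hF hQ hx U.subtype W.subtype (fun u u' => hUU u u.2 u' u'.2)
    ?_ (fun u h0 => Subtype.ext (hUW u u.2 fun w hw => h0 ⟨w, hw⟩))
    (fun w h0 => Subtype.ext (hWU w w.2 fun u hu => h0 ⟨u, hu⟩))
    ((x : V →ₗ[F] V).restrict hU) ((x : V →ₗ[F] V).restrict hW)
    ((x.symm : V →ₗ[F] V).restrict (symm_mem_of_invariant hW)) (fun _ => rfl) (fun _ => rfl)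
    (fun w => Subtype.ext (x.apply_symm_apply w)) (fun w => Subtype.ext (x.symm_apply_apply w))
    (irred_restrict hU hirr)
  intro w w'
  have hw' : (w' : V) ∈ W ⊓ LinearMap.BilinForm.orthogonal (polarBilin Q) W := by
    rw [h1]; exact w'.2
  exact LinearMap.BilinForm.mem_orthogonal_iff.1 hw'.2 w w.2

end InvariantSubspaces

end FiniteOrthogonal

end

/-! ### The main theorem -/

theorem mainTheorem5 {F V : Type*} [Field F] [Finite F] [AddCommGroup V] [Module F V]
    [FiniteDimensional F V] (n q : ℕ) (hq : Nat.card F = q) (hn : Module.finrank F V = n)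
    (hn3 : 3 ≤ n) (Q : QuadraticForm F V) (hQ : FiniteOrthogonal.NonSingular Q)
    (x : V ≃ₗ[F] V) (hx : x ∈ FiniteOrthogonal.Omega Q)
    (hss : FiniteOrthogonal.Semisimple x) :
    ((Odd q ∨ (Even q ∧ ¬ IsUnit ((x : Module.End F V) + 1))) →
      FiniteOrthogonal.conjClass (FiniteOrthogonal.Omega Q) x =
        FiniteOrthogonal.conjClass (FiniteOrthogonal.SO Q : Set (V ≃ₗ[F] V)) x) ∧
    ((Even q ∧ IsUnit ((x : Module.End F V) + 1)) →
      (∃ z ∈ FiniteOrthogonal.SO Q, z ∉ FiniteOrthogonal.Omega Q) ∧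
      ∀ z ∈ FiniteOrthogonal.SO Q, z ∉ FiniteOrthogonal.Omega Q →
        z⁻¹ * x * z ∈ FiniteOrthogonal.Omega Q ∧
        FiniteOrthogonal.conjClass (FiniteOrthogonal.SO Q : Set (V ≃ₗ[F] V)) x =
          FiniteOrthogonal.conjClass (FiniteOrthogonal.Omega Q) x ∪
            FiniteOrthogonal.conjClass (FiniteOrthogonal.Omega Q) (z⁻¹ * x * z) ∧
        Disjoint (FiniteOrthogonal.conjClass (FiniteOrthogonal.Omega Q) x)
          (FiniteOrthogonal.conjClass (FiniteOrthogonal.Omega Q) (z⁻¹ * x * z))) := by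
  open FiniteOrthogonal in
  subst hq hn
  let := Fintype.ofFinite F
  have hssx := isSemisimple_of_semisimple hss
  have hchar : Even (Nat.card F) → CharP F 2 := by
    intro h
    rw [Nat.card_eq_fintype_card, Nat.even_iff, ← FiniteField.even_card_iff_char_two] at h
    exact h ▸ ringChar.charP F
  refine ⟨?_, ?_⟩
  · rintro (hodd | ⟨heven, hsing⟩)
    · have hF : ringChar F ≠ 2 := by
        intro h
        rw [FiniteField.even_card_iff_char_two, ← Nat.even_iff, ← Nat.card_eq_fintype_card] at h
        exact Nat.not_even_iff_odd.2 hodd h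
      obtain ⟨c, hc, hθ, hxc⟩ := exists_commute_of_odd hF hn3 hQ hx.1.1 hssx
      exact conjClass_eq_of_commute hQ hc hθ hxc
    · have := hchar heven
      rw [isUnit_add_one_iff] at hsing
      push Not at hsing
      obtain ⟨v, hv, hv0⟩ := hsing
      obtain ⟨w, hw, hvw⟩ := exists_fixed_of_isSemisimple hQ hx.1.1 hssx hv hv0
      -- By polarization, one of v, w, v + w is anisotropic, and all three are fixed by x.
      obtain ⟨u, hu, hQu⟩ : ∃ u, x u = u ∧ Q u ≠ 0 := by
        rcases exists_anisotropic hvw with h | h | h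
        · exact ⟨v, hv, h⟩
        · exact ⟨w, hw, h⟩
        · exact ⟨v + w, by rw [map_add, hv, hw], h⟩
      exact conjClass_eq_of_commute hQ (det_eq_one_of_charTwo hQ (refl_mem hQu))
        (spinorNorm_refl_charTwo hQ heven hQu)
        (refl_commute hQu hx.1.1 (one_mul (1 : F)) (by rw [hu, one_smul])).symm
  · rintro ⟨heven, hunit⟩
    have := hchar heven
    rw [isUnit_add_one_iff] at hunit
    refine ⟨?_, fun z hz hzΩ => conjClass_split hQ hx hz hzΩ fun g hg hxg => ?_⟩
    · have : Nontrivial V := Module.nontrivial_of_finrank_pos (R := F) (by omega)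
      obtain ⟨v, hv0⟩ := exists_ne (0 : V)
      obtain ⟨w, hvw⟩ : ∃ w, QuadraticMap.polar Q v w ≠ 0 := by
        by_contra! h
        exact hv0 (eq_zero_of_polar hQ h)
      obtain ⟨u, hQu⟩ : ∃ u, Q u ≠ 0 := by
        rcases exists_anisotropic hvw with h | h | h <;> exact ⟨_, h⟩
      refine ⟨refl Q hQu, det_eq_one_of_charTwo hQ (refl_mem hQu), fun h => ?_⟩
      have h1 := h.2
      rw [spinorNorm_refl_charTwo hQ heven hQu] at h1
      exact one_ne_zero h1
    · rw [spinorNorm, if_pos heven, ZMod.natCast_eq_zero_iff_even]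
      exact even_finrank_residual_of_commute hQ hx.1.1 hg.1 hxg hunit
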